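/- Let $\ell_2$ be the complex Hilbert space with orthonormal basis $(e_i)_{i\in\mathbb N}$. Let $\boldsymbol Q\subseteq\mathbb C$ be any countable algebraically closed subfield that is closed under complex conjugation (for example $\overline{\mathbb Q}$), and let $\mathbb V\subseteq\ell_2$ be the $\boldsymbol Q$-linear span of $(e_i)$. Let $\mathcal U(\mathbb V)$ be the group of surjective $\boldsymbol Q$-linear isometries of $\mathbb V$ with the permutation group topology (pointwise convergence on $\mathbb V$ taken as a discrete set), and let $\mathcal U(\ell_2)$ be the unitary group of $\ell_2$ with the strong topology (pointwise convergence in norm). Both are Polish groups, and the following hold. 1. $\mathcal U(\mathbb V)$ has ample generics: writing $G=\mathcal U(\mathbb V)$, for each $m\geq 1$ the diagonal conjugacy action $g\cdot(h_1,\dots,h_m)=(gh_1g^{-1},\dots,gh_mg^{-1})$ of $G$ on $G^m$ has a comeagre orbit. 2. $\mathcal U(\mathbb V)$ has an ample cyclically dense conjugacy class: writing $G=\mathcal U(\mathbb V)$, there are $g\in G$ and a sequence $(h_k)_k\in G^{\mathbb N}$ such that $\{(g^nh_kg^{-n})_k : n\in\mathbb Z\}$ is dense in $G^{\mathbb N}$.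 3. $\mathcal U(\mathbb V)$ has the Bergman property: whenever $W_0\subseteq W_1\subseteq\cdots$ are subsets with $\bigcup_n W_n=\mathcal U(\mathbb V)$, there are $n$ and $k$ with $W_n^k=\mathcal U(\mathbb V)$. 4. Every element of $\mathcal U(\mathbb V)$ extends to a unique unitary operator on $\ell_2$, and the set of these extensions is dense in $\mathcal U(\ell_2)$. 5. $\mathcal U(\ell_2)$ has property (OB): whenever it acts by isometries on a metric space $X$ so that $g\mapsto gx$ is continuous for every $x\in X$, every orbit is bounded. 6. $\mathcal U(\ell_2)$ has an ample cyclically dense conjugacy class (defined as in 2, with $G=\mathcal U(\ell_2)$). -/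

import Mathlib

open scoped Pointwise ComplexConjugate

universe u v

/-- A group `G` has the Bergman property if for every increasing exhaustive sequence
`W 0 ⊆ W 1 ⊆ ⋯` of subsets of `G` there are `n` and `k` with `G = (W n) ^ k`, the set of all
products of `k` elements of `W n`. -/
def HasBergmanProperty (G : Type u) [Group G] : Prop :=
  ∀ W : ℕ → Set G, Monotone W → (⋃ n, W n) = Set.univ → ∃ n k : ℕ, (W n) ^ k = Set.univ

/-- A topological group `G` has property (OB) if, whenever `G` acts by isometries on a metric
space `X` in such a way that `g ↦ g • x` is continuous for every `x`, all orbits are bounded. -/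
def HasPropertyOB (G : Type u) [Group G] [TopologicalSpace G] : Prop :=
  ∀ (X : Type v) [MetricSpace X] [MulAction G X],
    (∀ g : G, Isometry fun x : X => g • x) →
    (∀ x : X, Continuous fun g : G => g • x) →
    ∀ x : X, Bornology.IsBounded (MulAction.orbit G x)

/-- A Polish group is a topological group whose topology is Polish. -/
def IsPolishGroup (G : Type u) [Group G] [TopologicalSpace G] : Prop :=
  IsTopologicalGroup G ∧ PolishSpace G

/-- The orbit of the tuple `h` under the diagonal conjugacy action
`g · (h₁, …, h_m) = (g h₁ g⁻¹, …, g h_m g⁻¹)` of `G` on `G ^ m`. -/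
def diagonalConjClass {G : Type u} [Group G] {m : ℕ} (h : Fin m → G) : Set (Fin m → G) :=
  Set.range fun g : G => fun i => g * h i * g⁻¹

/-- A Polish group `G` has ample generics if for each `m ≥ 1` the diagonal conjugacy action of
`G` on `G ^ m` has a comeagre orbit. -/
def HasAmpleGenerics (G : Type u) [Group G] [TopologicalSpace G] : Prop :=
  IsPolishGroup G ∧
    ∀ m : ℕ, 1 ≤ m → ∃ h : Fin m → G, diagonalConjClass h ∈ residual (Fin m → G)

/-- A Polish group `G` has an ample cyclically dense conjugacy class if there are `g ∈ G` and a
sequence `h ∈ G ^ ℕ` such that `{(g ^ n * h k * g ^ (-n))_k : n ∈ ℤ}` is dense in `G ^ ℕ`. -/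
def HasAmpleCyclicallyDenseConjClass (G : Type u) [Group G] [TopologicalSpace G] : Prop :=
  IsPolishGroup G ∧
    ∃ (g : G) (h : ℕ → G),
      Dense (Set.range fun n : ℤ => fun k : ℕ => g ^ n * h k * g ^ (-n))

/-- The complex Hilbert space `ℓ₂` on the countable orthonormal basis `(e_i)`. -/
abbrev EllTwo : Type := lp (fun _ : ℕ => ℂ) 2

/-- The basis vector `e_i` of `ℓ₂`. -/
noncomputable def ellTwoBasis (i : ℕ) : EllTwo := lp.single 2 i (1 : ℂ)

/-- The `Q`-linear span of the basis `(e_i)` in `ℓ₂`, with the norm of `ℓ₂`. -/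
noncomputable abbrev ratSpan (Q : Subfield ℂ) : Submodule Q EllTwo :=
  Submodule.span Q (Set.range ellTwoBasis)

/-- The group of (surjective) `Q`-linear isometries of the `Q`-span of the basis. -/
def UnitaryV (Q : Subfield ℂ) : Type := ratSpan Q ≃ₗᵢ[Q] ratSpan Q

noncomputable instance UnitaryV.instGroup (Q : Subfield ℂ) : Group (UnitaryV Q) :=
  inferInstanceAs (Group (ratSpan Q ≃ₗᵢ[Q] ratSpan Q))

noncomputable instance UnitaryV.instFunLike (Q : Subfield ℂ) : FunLike (UnitaryV Q) (ratSpan Q) (ratSpan Q) :=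
  inferInstanceAs (FunLike (ratSpan Q ≃ₗᵢ[Q] ratSpan Q) (ratSpan Q) (ratSpan Q))

/-- The permutation group topology: pointwise convergence, where the underlying set of the
`Q`-span carries the discrete topology `⊥`. -/
noncomputable instance UnitaryV.instTopologicalSpace (Q : Subfield ℂ) : TopologicalSpace (UnitaryV Q) :=
  TopologicalSpace.induced (fun (T : UnitaryV Q) (x : ratSpan Q) => T x)
    (@Pi.topologicalSpace (ratSpan Q) (fun _ => ratSpan Q) fun _ => ⊥)

/-- The unitary group of `ℓ₂`. -/
def UnitaryEllTwo : Type := EllTwo ≃ₗᵢ[ℂ] EllTwo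

noncomputable instance UnitaryEllTwo.instGroup : Group UnitaryEllTwo :=
  inferInstanceAs (Group (EllTwo ≃ₗᵢ[ℂ] EllTwo))

noncomputable instance UnitaryEllTwo.instFunLike : FunLike UnitaryEllTwo EllTwo EllTwo :=
  inferInstanceAs (FunLike (EllTwo ≃ₗᵢ[ℂ] EllTwo) EllTwo EllTwo)

/-- The strong topology: the weakest topology making all maps `T ↦ T x`, `x ∈ ℓ₂`, continuous
for the norm topology of `ℓ₂`. -/
noncomputable instance UnitaryEllTwo.instTopologicalSpace : TopologicalSpace UnitaryEllTwo :=
  TopologicalSpace.induced (fun (T : UnitaryEllTwo) (x : EllTwo) => T x) inferInstance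

/-- The unitary operator `S` of `ℓ₂` extends the isometry `T` of the `Q`-span. -/
def Extends {Q : Subfield ℂ} (S : UnitaryEllTwo) (T : UnitaryV Q) : Prop :=
  ∀ x : ratSpan Q, S (x : EllTwo) = (T x : EllTwo)

/-! Two tools carry the results on the `Q`-span. Witt's theorem (`exists_map_eq_of_inner_eq`):
finite families with equal Gram matrices are conjugate, by an isometry fixing every basis vector
outside the index set supporting both families. It is proved with reflections, whose coefficients
stay in `Q` because inner products do. Gluing (`exists_glue`): isometries with disjoint supports
have a direct sum. Hence every isometry agrees on finitely many basis vectors with one of finite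
support, and finite supports can be moved apart by permutations of the basis.

Ample generics: call a tuple generic if it preserves arbitrarily long initial spans and contains,
beyond any initial span, a copy of every tuple of finite support. Such tuples are comeagre, and a
back-and-forth argument conjugates any two of them.

Cyclic density: conjugation by a permutation displacing every finite set is topologically transitive
on sequences of isometries, so Baire category gives a dense orbit.

Bergman property: a diagonal gluing shows that some `W n` induces all isometries supported on some
infinite set. A commutator trick with two such sets bounds the whole subgroup supported on an
infinite coinfinite set. Permutations make the bound uniform, and every isometry is a product of two
to which it applies.

Passage to `ℓ₂`: Gram-Schmidt can be carried out in the `Q`-span since `Q` has square roots, so with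
Witt's theorem `extendHom` has dense image. Property (OB) then follows from the Bergman property
applied to sublevel sets of the displacement, and cyclic density is pushed forward. -/

open Filter Topology Set

local notation "⟪" x ", " y "⟫" => inner ℂ x y

/-! ### The Hilbert space and its unitary group -/

namespace EllTwo

theorem inner_basis_left (i : ℕ) (x : EllTwo) : ⟪ellTwoBasis i, x⟫ = x i := by
  simp [ellTwoBasis, lp.inner_single_left]

theorem inner_basis_right (i : ℕ) (x : EllTwo) : ⟪x, ellTwoBasis i⟫ = conj (x i) := by
  rw [← inner_conj_symm, inner_basis_left]

theorem basis_apply (i j : ℕ) : (ellTwoBasis i : EllTwo) j = if j = i then 1 else 0 := by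
  simp [ellTwoBasis, lp.single_apply, Pi.single_apply]

theorem orthonormal_basis : Orthonormal ℂ ellTwoBasis := by
  rw [orthonormal_iff_ite]
  intro i j
  rw [inner_basis_left, basis_apply]

theorem hasSum_basis (x : EllTwo) : HasSum (fun i => x i • ellTwoBasis i) x := by
  have h := lp.hasSum_single (E := fun _ : ℕ => ℂ) (p := 2) ENNReal.ofNat_ne_top x
  convert h using 2 with i
  rw [ellTwoBasis, ← lp.single_smul (E := fun _ : ℕ => ℂ) 2 i (x i) (1 : ℂ)]
  simp

theorem ext_inner_basis {x y : EllTwo} (h : ∀ i, ⟪ellTwoBasis i, x⟫ = ⟪ellTwoBasis i, y⟫) :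
    x = y := by
  ext i
  simpa [inner_basis_left] using h i

/-- Continuous linear maps agreeing on the basis are equal. -/
theorem clm_ext {F : Type*} [NormedAddCommGroup F] [NormedSpace ℂ F] {f g : EllTwo →L[ℂ] F}
    (h : ∀ i, f (ellTwoBasis i) = g (ellTwoBasis i)) : f = g := by
  ext x
  have h1 := (hasSum_basis x).mapL f
  have h2 := (hasSum_basis x).mapL g
  simp only [map_smul, h] at h1 h2
  exact h1.unique h2

/-- The isometry of `ℓ₂` sending the basis to a given orthonormal sequence. -/
theorem exists_isometry {x : ℕ → EllTwo} (hx : Orthonormal ℂ x) :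
    ∃ L : EllTwo →ₗᵢ[ℂ] EllTwo, ∀ i, L (ellTwoBasis i) = x i := by
  refine ⟨hx.orthogonalFamily.linearIsometry, fun i => ?_⟩
  rw [ellTwoBasis, OrthogonalFamily.linearIsometry_apply_single]
  simp

end EllTwo

namespace UnitaryEllTwo

noncomputable instance instSemilinearIsometryClass :
    SemilinearIsometryClass UnitaryEllTwo (RingHom.id ℂ) EllTwo EllTwo :=
  inferInstanceAs (SemilinearIsometryClass (EllTwo ≃ₗᵢ[ℂ] EllTwo) (RingHom.id ℂ) EllTwo EllTwo)

@[simp] theorem mul_apply (S T : UnitaryEllTwo) (x : EllTwo) : (S * T) x = S (T x) := rfl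

@[simp] theorem one_apply (x : EllTwo) : (1 : UnitaryEllTwo) x = x := rfl

@[simp] theorem inv_apply_self (S : UnitaryEllTwo) (x : EllTwo) : S⁻¹ (S x) = x :=
  LinearIsometryEquiv.symm_apply_apply (E := EllTwo) (E₂ := EllTwo) S x

@[simp] theorem apply_inv_self (S : UnitaryEllTwo) (x : EllTwo) : S (S⁻¹ x) = x :=
  LinearIsometryEquiv.apply_symm_apply (E := EllTwo) (E₂ := EllTwo) S x

theorem inner_map_map (S : UnitaryEllTwo) (x y : EllTwo) : ⟪S x, S y⟫ = ⟪x, y⟫ :=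
  LinearIsometryEquiv.inner_map_map (E' := EllTwo) S x y

theorem inner_map_left (S : UnitaryEllTwo) (x y : EllTwo) : ⟪S x, y⟫ = ⟪x, S⁻¹ y⟫ := by
  rw [← inner_map_map S x, apply_inv_self]

theorem dist_map (S : UnitaryEllTwo) (x y : EllTwo) : dist (S x) (S y) = dist x y := by
  rw [dist_eq_norm, dist_eq_norm, ← map_sub, SemilinearIsometryClass.norm_map]

theorem ext_basis {S T : UnitaryEllTwo} (h : ∀ i, S (ellTwoBasis i) = T (ellTwoBasis i)) :
    S = T := by
  have : (⟨⟨⟨S, map_add S⟩, map_smul S⟩, (SemilinearIsometryClass.isometry S).continuous⟩ :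
      EllTwo →L[ℂ] EllTwo) =
      ⟨⟨⟨T, map_add T⟩, map_smul T⟩, (SemilinearIsometryClass.isometry T).continuous⟩ :=
    EllTwo.clm_ext h
  exact DFunLike.ext _ _ fun x => DFunLike.congr_fun this x

/-- Two orthonormal sequences whose matrices are adjoint to each other are the sequences of
columns of a unitary operator and of its inverse. -/
theorem exists_of_adjoint {x y : ℕ → EllTwo} (hx : Orthonormal ℂ x) (hy : Orthonormal ℂ y)
    (hxy : ∀ i j, ⟪x i, ellTwoBasis j⟫ = ⟪ellTwoBasis i, y j⟫) :
    ∃ S : UnitaryEllTwo, (∀ i, S (ellTwoBasis i) = x i) ∧ ∀ j, S⁻¹ (ellTwoBasis j) = y j := by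
  obtain ⟨L, hL⟩ := EllTwo.exists_isometry hx
  obtain ⟨M, hM⟩ := EllTwo.exists_isometry hy
  -- Once `M` is the adjoint of `L`, the fact that both are isometric gives `M L = 1` and `L M = 1`.
  have hadj : ContinuousLinearMap.adjoint L.toContinuousLinearMap = M.toContinuousLinearMap := by
    refine EllTwo.clm_ext fun j => EllTwo.ext_inner_basis fun i => ?_
    rw [ContinuousLinearMap.adjoint_inner_right]
    simp [hL, hM, hxy]
  have key : ∀ a b, ⟪L a, b⟫ = ⟪a, M b⟫ := fun a b => by
    have := ContinuousLinearMap.adjoint_inner_right L.toContinuousLinearMap a b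
    rw [hadj] at this
    exact this.symm
  have hML : ∀ a, M (L a) = a := fun a => by
    refine ext_inner_left ℂ fun v => ?_
    rw [← key, L.inner_map_map]
  have hLM : ∀ a, L (M a) = a := fun a => by
    refine ext_inner_right ℂ fun v => ?_
    rw [key, M.inner_map_map]
  let E : EllTwo ≃ₗᵢ[ℂ] EllTwo :=
    ⟨LinearEquiv.ofLinearMap L.toLinearMap M.toLinearMap (LinearMap.ext hLM) (LinearMap.ext hML),
      L.norm_map⟩
  exact ⟨E, hL, hM⟩

theorem tendsto_nhds {α : Type*} {l : Filter α} {F : α → UnitaryEllTwo} {S : UnitaryEllTwo} :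
    Tendsto F l (𝓝 S) ↔ ∀ x, Tendsto (fun a => F a x) l (𝓝 (S x)) := by
  rw [(Topology.IsInducing.mk rfl : Topology.IsInducing
    fun (T : UnitaryEllTwo) (x : EllTwo) => T x).tendsto_nhds_iff, tendsto_pi_nhds]
  rfl

/-- Convergence on the basis implies strong convergence. -/
theorem tendsto_of_basis {α : Type*} {l : Filter α} {F : α → UnitaryEllTwo} {S : UnitaryEllTwo}
    (h : ∀ i, Tendsto (fun a => F a (ellTwoBasis i)) l (𝓝 (S (ellTwoBasis i)))) :
    Tendsto F l (𝓝 S) := by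
  rw [tendsto_nhds]
  have hspan : ∀ x ∈ Submodule.span ℂ (range ellTwoBasis),
      Tendsto (fun a => F a x) l (𝓝 (S x)) := by
    intro x hx
    induction hx using Submodule.span_induction with
    | mem x hx => obtain ⟨i, rfl⟩ := hx; exact h i
    | zero => simp [tendsto_const_nhds]
    | add x y _ _ hx hy => simpa using hx.add hy
    | smul c x _ hx => simpa using hx.const_smul c
  intro x
  rw [Metric.tendsto_nhds]
  intro ε hε
  have hx : x ∈ closure (Submodule.span ℂ (range ellTwoBasis) : Set EllTwo) :=
    mem_closure_of_tendsto (EllTwo.hasSum_basis x) (Eventually.of_forall fun s =>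
      Submodule.sum_mem _ fun i _ => Submodule.smul_mem _ _ (Submodule.subset_span ⟨i, rfl⟩))
  obtain ⟨y, hy, hxy⟩ := Metric.mem_closure_iff.1 hx (ε / 3) (by positivity)
  filter_upwards [Metric.tendsto_nhds.1 (hspan y hy) (ε / 3) (by positivity)] with a ha
  have h1 := dist_map (F a) x y
  have h2 := dist_map S y x
  have h3 := dist_triangle4 (F a x) (F a y) (S y) (S x)
  rw [dist_comm] at hxy
  linarith [dist_comm x y]

theorem continuous_eval (x : EllTwo) : Continuous fun S : UnitaryEllTwo => S x :=
  (continuous_apply x).comp continuous_induced_dom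

instance instIsTopologicalGroup : IsTopologicalGroup UnitaryEllTwo where
  continuous_mul := by
    rw [continuous_iff_continuousAt]
    rintro ⟨S, T⟩
    refine tendsto_nhds.2 fun x => ?_
    have hT : Tendsto (fun p : UnitaryEllTwo × UnitaryEllTwo => p.2 x) (𝓝 (S, T)) (𝓝 (T x)) :=
      ((continuous_eval x).comp continuous_snd).tendsto (S, T)
    have hS : Tendsto (fun p : UnitaryEllTwo × UnitaryEllTwo => p.1 (T x)) (𝓝 (S, T))
        (𝓝 (S (T x))) := ((continuous_eval (T x)).comp continuous_fst).tendsto (S, T)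
    rw [tendsto_iff_dist_tendsto_zero] at hS hT ⊢
    refine squeeze_zero (fun _ => dist_nonneg) (fun p => ?_) (by simpa using hT.add hS)
    have := dist_triangle (p.1 (p.2 x)) (p.1 (T x)) (S (T x))
    rwa [dist_map] at this
  continuous_inv := by
    rw [continuous_iff_continuousAt]
    intro S
    refine tendsto_nhds.2 fun x => ?_
    have hS : Tendsto (fun T : UnitaryEllTwo => T (S⁻¹ x)) (𝓝 S) (𝓝 (S (S⁻¹ x))) :=
      (continuous_eval _).tendsto S
    rw [tendsto_iff_dist_tendsto_zero] at hS ⊢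
    refine hS.congr fun T => ?_
    rw [← dist_map T (T⁻¹ x), apply_inv_self, apply_inv_self, dist_comm]

/-- The columns of a unitary operator and of its inverse. -/
noncomputable def columns (S : UnitaryEllTwo) : (ℕ → EllTwo) × (ℕ → EllTwo) :=
  (fun i => S (ellTwoBasis i), fun i => S⁻¹ (ellTwoBasis i))

/-- The columns of the inverse are recorded because orthonormality of the columns of `S` alone only
yields an isometry, possibly not onto. With both families every condition is closed, whence
Polishness. -/
theorem range_columns : range columns = {p | (∀ i j, ⟪p.1 i, p.1 j⟫ = if i = j then 1 else 0) ∧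
    (∀ i j, ⟪p.2 i, p.2 j⟫ = if i = j then 1 else 0) ∧
    ∀ i j, ⟪p.1 i, ellTwoBasis j⟫ = ⟪ellTwoBasis i, p.2 j⟫} := by
  have he := orthonormal_iff_ite.1 EllTwo.orthonormal_basis
  ext ⟨x, y⟩
  constructor
  · rintro ⟨S, hS⟩
    obtain ⟨rfl, rfl⟩ := Prod.mk.inj hS
    exact ⟨fun i j => by rw [inner_map_map, he], fun i j => by rw [inner_map_map, he],
      fun i j => inner_map_left S _ _⟩
  · rintro ⟨hx, hy, hxy⟩
    obtain ⟨S, h1, h2⟩ :=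
      exists_of_adjoint (orthonormal_iff_ite.2 hx) (orthonormal_iff_ite.2 hy) hxy
    exact ⟨S, Prod.ext (funext h1) (funext h2)⟩

theorem isClosedEmbedding_columns : Topology.IsClosedEmbedding columns := by
  refine ⟨⟨?_, fun S T h => ext_basis (congr_fun (congr_arg Prod.fst h))⟩, ?_⟩
  · rw [Topology.isInducing_iff_nhds]
    intro S
    refine le_antisymm ?_ ?_
    · refine map_le_iff_le_comap.1 (Continuous.tendsto ?_ S)
      exact (continuous_pi fun i => continuous_eval _).prodMk
        (continuous_pi fun i => (continuous_eval _).comp continuous_inv)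
    · refine tendsto_id'.1 ?_
      refine tendsto_of_basis fun i => ?_
      have : Continuous fun p : (ℕ → EllTwo) × (ℕ → EllTwo) => p.1 i := by fun_prop
      exact (this.tendsto (columns S)).comp tendsto_comap
  · rw [range_columns]
    simp only [ofPred_and, ofPred_forall]
    refine IsClosed.inter ?_ (IsClosed.inter ?_ ?_) <;>
    exact isClosed_iInter fun i => isClosed_iInter fun j => isClosed_eq (by fun_prop) (by fun_prop)

end UnitaryEllTwo

instance EllTwo.instSeparableSpace : TopologicalSpace.SeparableSpace EllTwo := by
  rw [← TopologicalSpace.isSeparable_univ_iff]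
  have h : TopologicalSpace.IsSeparable
      (closure (Submodule.span ℂ (range ellTwoBasis) : Set EllTwo)) :=
    ((countable_range ellTwoBasis).isSeparable.span (R := ℂ)).closure
  refine h.mono fun x _ => mem_closure_of_tendsto (EllTwo.hasSum_basis x) ?_
  exact Eventually.of_forall fun s =>
    Submodule.sum_mem _ fun i _ => Submodule.smul_mem _ _ (Submodule.subset_span ⟨i, rfl⟩)

instance UnitaryEllTwo.instPolishSpace : PolishSpace UnitaryEllTwo := by
  have : SecondCountableTopology EllTwo := UniformSpace.secondCountable_of_separable EllTwo
  exact UnitaryEllTwo.isClosedEmbedding_columns.polishSpace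

theorem UnitaryEllTwo.isPolishGroup : IsPolishGroup UnitaryEllTwo :=
  ⟨inferInstance, inferInstance⟩

/-! ### The `Q`-span of the basis and its isometry group -/

theorem Subfield.I_mem_of_isAlgClosed (Q : Subfield ℂ) [IsAlgClosed Q] : Complex.I ∈ Q := by
  obtain ⟨z, hz⟩ := IsAlgClosed.exists_pow_nat_eq (-1 : Q) (n := 2) (by norm_num)
  have h : (z : ℂ) ^ 2 = Complex.I ^ 2 := by
    rw [Complex.I_sq]
    exact_mod_cast congr_arg (Subtype.val) hz
  rcases sq_eq_sq_iff_eq_or_eq_neg.1 h with h | h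
  · exact h ▸ z.2
  · rw [← neg_neg Complex.I, ← h]
    exact Q.neg_mem z.2

/-- Used for norms, whose squares are inner products and so lie in `Q`. -/
theorem Subfield.ofReal_mem_of_sq_mem (Q : Subfield ℂ) [IsAlgClosed Q] {r : ℝ}
    (h : (r : ℂ) ^ 2 ∈ Q) : (r : ℂ) ∈ Q := by
  obtain ⟨z, hz⟩ := IsAlgClosed.exists_pow_nat_eq (⟨_, h⟩ : Q) (n := 2) (by norm_num)
  have h : (r : ℂ) ^ 2 = (z : ℂ) ^ 2 := (congr_arg (Subtype.val) hz).symm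
  rcases sq_eq_sq_iff_eq_or_eq_neg.1 h with h | h
  · exact h ▸ z.2
  · rw [h]
    exact Q.neg_mem z.2

namespace ratSpan

variable (Q : Subfield ℂ)

theorem linearIndependent_basis : LinearIndependent Q ellTwoBasis :=
  EllTwo.orthonormal_basis.linearIndependent.restrict_scalars' Q

/-- The vectors `e_i` as a `Q`-basis of their `Q`-span. -/
noncomputable def basis : Module.Basis ℕ Q (ratSpan Q) :=
  Module.Basis.span (linearIndependent_basis Q)

variable {Q}

@[simp] theorem coe_basis (i : ℕ) : (basis Q i : EllTwo) = ellTwoBasis i := by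
  rw [basis, Module.Basis.span_apply]

theorem coe_smul (c : Q) (x : ratSpan Q) :
    ((c • x : ratSpan Q) : EllTwo) = (c : ℂ) • (x : EllTwo) :=
  rfl

theorem coe_repr (x : ratSpan Q) (i : ℕ) : ((basis Q).repr x i : ℂ) = (x : EllTwo) i := by
  conv_rhs => rw [← (basis Q).linearCombination_repr x, Finsupp.linearCombination_apply,
    Finsupp.sum, ← EllTwo.inner_basis_left]
  simp only [Submodule.coe_sum, coe_smul, inner_sum, inner_smul_right, coe_basis,
    orthonormal_iff_ite.1 EllTwo.orthonormal_basis]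
  simp

/-- This is where closure under conjugation enters; it keeps reflections and projections inside the
`Q`-span. -/
theorem inner_mem (hQ : ∀ z ∈ Q, conj z ∈ Q) (x y : ratSpan Q) :
    ⟪(x : EllTwo), (y : EllTwo)⟫ ∈ Q := by
  rw [← (basis Q).linearCombination_repr y, Finsupp.linearCombination_apply, Finsupp.sum]
  simp only [Submodule.coe_sum, coe_smul, inner_sum, inner_smul_right, coe_basis,
    EllTwo.inner_basis_right, ← coe_repr]
  exact Q.sum_mem fun i _ => Q.mul_mem (SetLike.coe_mem _) (hQ _ (SetLike.coe_mem _))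

instance instCountable [Countable Q] : Countable (ratSpan Q) :=
  (basis Q).repr.toEquiv.countable_iff.2 inferInstance

/-- The vector `x` of the `Q`-span is a combination of the `e_i` with `i ∈ A`. -/
def SupportedIn (A : Set ℕ) (x : ratSpan Q) : Prop := ∀ j, j ∉ A → (x : EllTwo) j = 0

namespace SupportedIn

variable {A B : Set ℕ} {x y : ratSpan Q}

theorem mono (h : A ⊆ B) (hx : SupportedIn A x) : SupportedIn B x := fun j hj =>
  hx j fun hA => hj (h hA)

theorem basis {i : ℕ} (hi : i ∈ A) : SupportedIn A (ratSpan.basis Q i) := fun j hj => by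
  rw [coe_basis, EllTwo.basis_apply, if_neg]
  rintro rfl
  exact hj hi

theorem sub (hx : SupportedIn A x) (hy : SupportedIn A y) : SupportedIn A (x - y) := fun j hj => by
  simp [hx j hj, hy j hj]

theorem add (hx : SupportedIn A x) (hy : SupportedIn A y) : SupportedIn A (x + y) := fun j hj => by
  simp [hx j hj, hy j hj]

theorem smul (c : Q) (hx : SupportedIn A x) : SupportedIn A (c • x) := fun j hj => by
  rw [coe_smul]
  simp [hx j hj]

theorem eq_sum (hx : SupportedIn A x) :
    ∃ (s : Finset ℕ) (c : ℕ → Q), (∀ i ∈ s, i ∈ A) ∧ x = ∑ i ∈ s, c i • ratSpan.basis Q i := by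
  refine ⟨((ratSpan.basis Q).repr x).support, (ratSpan.basis Q).repr x, fun i hi => ?_,
    ((ratSpan.basis Q).linearCombination_repr x).symm⟩
  by_contra hA
  have := hx i hA
  rw [← coe_repr] at this
  exact (Finsupp.mem_support_iff.1 hi) (by exact_mod_cast this)

theorem inner_eq_zero (hAB : Disjoint A B) (hx : SupportedIn A x) (hy : SupportedIn B y) :
    ⟪(x : EllTwo), (y : EllTwo)⟫ = 0 := by
  rw [lp.inner_eq_tsum]
  refine (tsum_congr fun i => ?_).trans tsum_zero
  by_cases hi : i ∈ A
  · rw [hy i (Set.disjoint_left.1 hAB hi), inner_zero_right]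
  · rw [hx i hi, inner_zero_left]

end SupportedIn

theorem exists_supportedIn_Iio (x : ratSpan Q) : ∃ K, ∀ L, K ≤ L → SupportedIn (Iio L) x := by
  obtain ⟨K, hK⟩ := ((basis Q).repr x).support.exists_nat_subset_range
  refine ⟨K, fun L hL j hj => ?_⟩
  rw [← coe_repr]
  by_contra h
  have := hK (Finsupp.mem_support_iff.2 fun h0 => h (congr_arg Subtype.val h0))
  simp only [Finset.mem_range, mem_Iio] at this hj
  omega

theorem exists_supportedIn_Iio_of_finite {ι : Type*} [Finite ι] (x : ι → ratSpan Q) :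
    ∃ K, ∀ L, K ≤ L → ∀ i, SupportedIn (Iio L) (x i) := by
  choose K hK using fun i => exists_supportedIn_Iio (x i)
  obtain ⟨M, hM⟩ := (Set.finite_range K).bddAbove
  exact ⟨M, fun L hL i => hK i L ((hM ⟨i, rfl⟩).trans hL)⟩

end ratSpan

namespace UnitaryV

open ratSpan

variable {Q : Subfield ℂ}

noncomputable instance instSemilinearIsometryClass :
    SemilinearIsometryClass (UnitaryV Q) (RingHom.id Q) (ratSpan Q) (ratSpan Q) :=
  inferInstanceAs (SemilinearIsometryClass (ratSpan Q ≃ₗᵢ[Q] ratSpan Q) (RingHom.id Q)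
    (ratSpan Q) (ratSpan Q))

@[simp] theorem mul_apply (S T : UnitaryV Q) (x : ratSpan Q) : (S * T) x = S (T x) := rfl

@[simp] theorem one_apply (x : ratSpan Q) : (1 : UnitaryV Q) x = x := rfl

@[simp] theorem inv_apply_self (T : UnitaryV Q) (x : ratSpan Q) : T⁻¹ (T x) = x :=
  LinearIsometryEquiv.symm_apply_apply (E := ratSpan Q) (E₂ := ratSpan Q) T x

@[simp] theorem apply_inv_self (T : UnitaryV Q) (x : ratSpan Q) : T (T⁻¹ x) = x :=
  LinearIsometryEquiv.apply_symm_apply (E := ratSpan Q) (E₂ := ratSpan Q) T x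

theorem inv_apply_eq_iff {T : UnitaryV Q} {x y : ratSpan Q} : T⁻¹ x = y ↔ x = T y :=
  ⟨fun h => by rw [← h, apply_inv_self], fun h => by rw [h, inv_apply_self]⟩

theorem ext_basis {S T : UnitaryV Q} (h : ∀ i, S (basis Q i) = T (basis Q i)) : S = T := by
  have : (⟨⟨S, map_add S⟩, map_smul S⟩ : ratSpan Q →ₗ[Q] ratSpan Q) =
      ⟨⟨T, map_add T⟩, map_smul T⟩ :=
    (basis Q).ext h
  exact DFunLike.ext _ _ fun x => DFunLike.congr_fun this x

theorem apply_eq_of_supportedIn {S T : UnitaryV Q} {A : Set ℕ}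
    (h : ∀ i ∈ A, S (basis Q i) = T (basis Q i)) {x : ratSpan Q} (hx : SupportedIn A x) :
    S x = T x := by
  obtain ⟨s, c, hs, rfl⟩ := hx.eq_sum
  simp only [map_sum, map_smul]
  exact Finset.sum_congr rfl fun i hi => by rw [h i (hs i hi)]

section Inner

variable [IsAlgClosed Q]

/-- Complex polarization applies to a merely `Q`-linear isometry because `Q` contains `Complex.I`.
-/
theorem inner_map_map (T : UnitaryV Q) (x y : ratSpan Q) :
    ⟪(T x : EllTwo), (T y : EllTwo)⟫ = ⟪(x : EllTwo), (y : EllTwo)⟫ := by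
  have hI : ∀ x : ratSpan Q, ((Complex.I : ℂ) • (x : EllTwo)) =
      (((⟨Complex.I, Q.I_mem_of_isAlgClosed⟩ : Q) • x : ratSpan Q) : EllTwo) := fun _ => rfl
  have hn : ∀ x : ratSpan Q, ‖(T x : EllTwo)‖ = ‖(x : EllTwo)‖ := fun x =>
    SemilinearIsometryClass.norm_map T x
  rw [inner_eq_sum_norm_sq_div_four, inner_eq_sum_norm_sq_div_four]
  simp only [Complex.coe_algebraMap, RCLike.I_to_complex]
  simp only [hI, ← Submodule.coe_add, ← Submodule.coe_sub, ← map_smul, ← map_add, ← map_sub, hn]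

theorem inner_map_left (T : UnitaryV Q) (x y : ratSpan Q) :
    ⟪(T x : EllTwo), (y : EllTwo)⟫ = ⟪(x : EllTwo), (T⁻¹ y : EllTwo)⟫ := by
  rw [← inner_map_map T x, apply_inv_self]

theorem inner_map_right (T : UnitaryV Q) (x y : ratSpan Q) :
    ⟪(x : EllTwo), (T y : EllTwo)⟫ = ⟪(T⁻¹ x : EllTwo), (y : EllTwo)⟫ := by
  rw [← inner_map_map T _ y, apply_inv_self]

theorem orthonormal_map_basis (T : UnitaryV Q) :
    Orthonormal ℂ fun i => (T (basis Q i) : EllTwo) := by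
  rw [orthonormal_iff_ite]
  intro i j
  rw [inner_map_map, coe_basis, coe_basis, orthonormal_iff_ite.1 EllTwo.orthonormal_basis]

theorem exists_extends (T : UnitaryV Q) : ∃ S : UnitaryEllTwo, Extends S T := by
  obtain ⟨S, hS, -⟩ := UnitaryEllTwo.exists_of_adjoint T.orthonormal_map_basis
    T⁻¹.orthonormal_map_basis fun i j => by
      rw [← coe_basis (Q := Q), ← coe_basis (Q := Q), inner_map_left]
  refine ⟨S, fun x => ?_⟩
  obtain ⟨s, c, -, rfl⟩ := (show SupportedIn univ x from fun j hj => (hj trivial).elim).eq_sum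
  simp only [map_sum, map_smul, Submodule.coe_sum, coe_smul, coe_basis, hS]

end Inner

theorem extends_unique {S S' : UnitaryEllTwo} {T : UnitaryV Q} (h : Extends S T)
    (h' : Extends S' T) : S = S' :=
  UnitaryEllTwo.ext_basis fun i => by
    rw [← coe_basis (Q := Q), h, h']

/-- A unitary operator of `ℓ₂` that preserves the `Q`-span restricts to it. -/
theorem exists_restriction (S : UnitaryEllTwo) (h : ∀ x ∈ ratSpan Q, S x ∈ ratSpan Q)
    (h' : ∀ x ∈ ratSpan Q, S⁻¹ x ∈ ratSpan Q) :
    ∃ T : UnitaryV Q, (∀ x : ratSpan Q, (T x : EllTwo) = S x) ∧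
      ∀ x : ratSpan Q, (T⁻¹ x : EllTwo) = S⁻¹ x := by
  let E : ratSpan Q ≃ₗᵢ[Q] ratSpan Q :=
    { toFun := fun x => ⟨S x, h x x.2⟩
      invFun := fun x => ⟨S⁻¹ x, h' x x.2⟩
      left_inv := fun x => Subtype.ext (S.inv_apply_self x)
      right_inv := fun x => Subtype.ext (S.apply_inv_self x)
      map_add' := fun x y => Subtype.ext (map_add S (x : EllTwo) y)
      map_smul' := fun c x => Subtype.ext (map_smul S (c : ℂ) (x : EllTwo))
      norm_map' := fun x => SemilinearIsometryClass.norm_map S (x : EllTwo) }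
  exact ⟨E, fun _ => rfl, fun _ => rfl⟩

/-- Two orthonormal sequences in the `Q`-span whose matrices are adjoint to each other are the
sequences of columns of an isometry of the `Q`-span and of its inverse. -/
theorem exists_of_adjoint {x y : ℕ → ratSpan Q} (hx : Orthonormal ℂ fun i => (x i : EllTwo))
    (hy : Orthonormal ℂ fun i => (y i : EllTwo))
    (hxy : ∀ i j, ⟪(x i : EllTwo), ellTwoBasis j⟫ = ⟪ellTwoBasis i, (y j : EllTwo)⟫) :
    ∃ T : UnitaryV Q, (∀ i, T (basis Q i) = x i) ∧ ∀ j, T⁻¹ (basis Q j) = y j := by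
  obtain ⟨S, hS, hS'⟩ := UnitaryEllTwo.exists_of_adjoint hx hy hxy
  have hmem : ∀ (S : UnitaryEllTwo) (x : ℕ → ratSpan Q), (∀ i, S (ellTwoBasis i) = x i) →
      ∀ z ∈ ratSpan Q, S z ∈ ratSpan Q := by
    intro S x hS z hz
    induction hz using Submodule.span_induction with
    | mem z hz => obtain ⟨i, rfl⟩ := hz; rw [hS]; exact (x i).2
    | zero => rw [map_zero]; exact Submodule.zero_mem _
    | add a b _ _ ha hb => rw [map_add]; exact Submodule.add_mem _ ha hb
    | smul c a _ ha =>
      rw [Subfield.smul_def, map_smul]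
      exact Submodule.smul_mem _ c ha
  obtain ⟨T, hT, hT'⟩ := exists_restriction S (hmem S x hS) (hmem S⁻¹ y hS')
  exact ⟨T, fun i => Subtype.ext (by rw [hT, coe_basis, hS]),
    fun i => Subtype.ext (by rw [hT', coe_basis, hS'])⟩

end UnitaryV

/-! ### Isometries supported on sets of basis vectors, and Witt's theorem -/

/-- The hypothesis on `c` is what cancels the cross terms, making this rank-one perturbation of the
identity isometric. By the next lemma its adjoint has the same form with `conj c`. -/
theorem EllTwo.inner_reflection {u : EllTwo} {c : ℂ} (h : c + conj c = c * conj c * ⟪u, u⟫)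
    (a b : EllTwo) :
    ⟪a - (c * ⟪u, a⟫) • u, b - (c * ⟪u, b⟫) • u⟫ = ⟪a, b⟫ := by
  simp only [inner_sub_left, inner_sub_right, inner_smul_left, inner_smul_right, map_mul,
    inner_conj_symm]
  linear_combination (-⟪u, b⟫ * ⟪a, u⟫) * h

theorem EllTwo.inner_reflection_left (u : EllTwo) (c : ℂ) (a b : EllTwo) :
    ⟪a - (c * ⟪u, a⟫) • u, b⟫ = ⟪a, b - (conj c * ⟪u, b⟫) • u⟫ := by
  simp only [inner_sub_left, inner_sub_right, inner_smul_left, inner_smul_right, map_mul,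
    inner_conj_symm]
  ring

namespace UnitaryV

open ratSpan

variable {Q : Subfield ℂ}

/-- The subgroup of isometries fixing every `e_j` with `j ∉ A`. -/
def supportSubgroup (Q : Subfield ℂ) (A : Set ℕ) : Subgroup (UnitaryV Q) where
  carrier := {T | ∀ j, j ∉ A → T (basis Q j) = basis Q j}
  mul_mem' := fun {S T} hS hT j hj => by rw [mul_apply, hT j hj, hS j hj]
  one_mem' := fun _ _ => rfl
  inv_mem' := fun {T} hT j hj => by rw [inv_apply_eq_iff, hT j hj]

theorem supportSubgroup_mono {A B : Set ℕ} (h : A ⊆ B) :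
    supportSubgroup Q A ≤ supportSubgroup Q B := fun _ hT j hj => hT j fun hA => hj (h hA)

theorem apply_eq_self_of_mem {A B : Set ℕ} {T : UnitaryV Q} (hT : T ∈ supportSubgroup Q A)
    (hAB : Disjoint A B) {x : ratSpan Q} (hx : SupportedIn B x) : T x = x :=
  apply_eq_of_supportedIn (T := 1) (fun j hj => hT j (Set.disjoint_right.1 hAB hj)) hx

section

variable [IsAlgClosed Q]

/-- Control of the inverse on basis vectors thus becomes control of the support of `T x`. -/
theorem coe_apply_apply (T : UnitaryV Q) (x : ratSpan Q) (j : ℕ) :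
    (T x : EllTwo) j = ⟪(T⁻¹ (basis Q j) : EllTwo), (x : EllTwo)⟫ := by
  rw [← EllTwo.inner_basis_left, ← coe_basis (Q := Q), inner_map_right]

theorem supportedIn_of_mem {A B : Set ℕ} {T : UnitaryV Q} (hT : T ∈ supportSubgroup Q A)
    (hAB : A ⊆ B) {x : ratSpan Q} (hx : SupportedIn B x) : SupportedIn B (T x) := fun j hj => by
  rw [coe_apply_apply, inv_mem hT j fun hA => hj (hAB hA), coe_basis, EllTwo.inner_basis_left,
    hx j hj]

theorem commute_of_mem {A B : Set ℕ} (hAB : Disjoint A B) {S T : UnitaryV Q}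
    (hS : S ∈ supportSubgroup Q A) (hT : T ∈ supportSubgroup Q B) : Commute S T := by
  refine ext_basis fun i => ?_
  rw [mul_apply, mul_apply]
  by_cases hi : i ∈ A
  · rw [hT i (Set.disjoint_left.1 hAB hi), apply_eq_self_of_mem hT hAB.symm
      (supportedIn_of_mem hS subset_rfl (.basis hi))]
  · rw [hS i hi]
    by_cases hB : i ∈ B
    · rw [apply_eq_self_of_mem hS hAB (supportedIn_of_mem hT subset_rfl (.basis hB))]
    · rw [hT i hB, hS i hi]

end

/-- Two vectors of the same norm are exchanged by a unitary reflection along their difference. -/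
theorem exists_reflection (hQ : ∀ z ∈ Q, conj z ∈ Q) {A : Set ℕ} {x y : ratSpan Q}
    (hx : SupportedIn A x) (hy : SupportedIn A y)
    (hxy : ⟪(x : EllTwo), (x : EllTwo)⟫ = ⟪(y : EllTwo), (y : EllTwo)⟫) :
    ∃ R ∈ supportSubgroup Q A, R x = y ∧
      ∀ z : ratSpan Q, ⟪(x : EllTwo), (z : EllTwo)⟫ = ⟪(y : EllTwo), (z : EllTwo)⟫ → R z = z := by
  by_cases hne : x = y
  · exact ⟨1, one_mem _, hne, fun _ _ => rfl⟩
  obtain ⟨u, hu⟩ : ∃ u : ratSpan Q, u = x - y := ⟨_, rfl⟩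
  have hu' : (u : EllTwo) = (x : EllTwo) - y := by rw [hu]; rfl
  -- The coefficient is `d⁻¹`, chosen so that `x` goes to `x - u = y`. Equality of norms gives `d +
  -- conj d = ⟪u, u⟫`, which is both the isometry condition and the reason that `d ≠ 0`.
  obtain ⟨d, hd⟩ : ∃ d, d = ⟪(u : EllTwo), (x : EllTwo)⟫ := ⟨_, rfl⟩
  have hdd : d + conj d = ⟪(u : EllTwo), (u : EllTwo)⟫ := by
    rw [hd, inner_conj_symm]
    simp only [hu', inner_sub_left, inner_sub_right]
    linear_combination hxy
  have hd0 : d ≠ 0 := by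
    intro h0
    rw [h0, map_zero, add_zero, eq_comm, inner_self_eq_zero, hu', sub_eq_zero] at hdd
    exact hne (Subtype.ext hdd)
  have hd0' : conj d ≠ 0 := (map_ne_zero _).2 hd0
  have hdQ : d ∈ Q := hd ▸ inner_mem hQ u x
  have hc : d⁻¹ + conj d⁻¹ = d⁻¹ * conj d⁻¹ * ⟪(u : EllTwo), (u : EllTwo)⟫ := by
    rw [← hdd, map_inv₀]
    field_simp
    ring
  have hc' : conj d⁻¹ + conj (conj d⁻¹) =
      conj d⁻¹ * conj (conj d⁻¹) * ⟪(u : EllTwo), (u : EllTwo)⟫ := by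
    rw [Complex.conj_conj]
    linear_combination hc
  have hmem : ∀ c ∈ Q, ∀ z : ratSpan Q,
      (z : EllTwo) - (c * ⟪(u : EllTwo), (z : EllTwo)⟫) • (u : EllTwo) ∈ ratSpan Q := fun c hcQ z =>
    Submodule.sub_mem _ z.2 (Submodule.smul_mem _
      (⟨_, Q.mul_mem hcQ (inner_mem hQ u z)⟩ : Q) u.2)
  obtain ⟨R, hR, -⟩ := exists_of_adjoint (Q := Q)
    (x := fun i => ⟨_, hmem d⁻¹ (Q.inv_mem hdQ) (basis Q i)⟩)
    (y := fun i => ⟨_, hmem (conj d⁻¹) (hQ _ (Q.inv_mem hdQ)) (basis Q i)⟩)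
    (orthonormal_iff_ite.2 fun i j => by
      rw [EllTwo.inner_reflection hc, coe_basis, coe_basis,
        orthonormal_iff_ite.1 EllTwo.orthonormal_basis])
    (orthonormal_iff_ite.2 fun i j => by
      rw [EllTwo.inner_reflection hc', coe_basis, coe_basis,
        orthonormal_iff_ite.1 EllTwo.orthonormal_basis])
    (fun i j => by
      rw [← coe_basis (Q := Q), ← coe_basis (Q := Q), EllTwo.inner_reflection_left])
  have hRz : ∀ z : ratSpan Q,
      (R z : EllTwo) = (z : EllTwo) - (d⁻¹ * ⟪(u : EllTwo), (z : EllTwo)⟫) • (u : EllTwo) := by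
    intro z
    obtain ⟨s, c, -, rfl⟩ := (show SupportedIn univ z from fun j hj => (hj trivial).elim).eq_sum
    simp only [map_sum, map_smul, Submodule.coe_sum, coe_smul, hR, inner_sum, inner_smul_right,
      Finset.mul_sum, Finset.sum_smul, ← Finset.sum_sub_distrib, smul_sub, smul_smul]
    exact Finset.sum_congr rfl fun i _ => by rw [mul_left_comm]
  refine ⟨R, fun j hj => Subtype.ext ?_, Subtype.ext ?_, fun z hz => Subtype.ext ?_⟩
  · rw [hRz, coe_basis, EllTwo.inner_basis_right, hu, hx.sub hy j hj, map_zero, mul_zero, zero_smul,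
      sub_zero]
  · rw [hRz, ← hd, inv_mul_cancel₀ hd0, one_smul, hu', sub_sub_cancel]
  · rw [hRz, hu', inner_sub_left, hz, sub_self, mul_zero, zero_smul, sub_zero]

section

variable [IsAlgClosed Q]

/-- Witt's theorem: finite families with the same Gram matrix are conjugate. -/
theorem exists_map_eq_of_inner_eq (hQ : ∀ z ∈ Q, conj z ∈ Q) {A : Set ℕ} {n : ℕ}
    {x y : ℕ → ratSpan Q} (hx : ∀ i < n, SupportedIn A (x i)) (hy : ∀ i < n, SupportedIn A (y i))
    (hxy : ∀ i < n, ∀ j < n,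
      ⟪(x i : EllTwo), (x j : EllTwo)⟫ = ⟪(y i : EllTwo), (y j : EllTwo)⟫) :
    ∃ T ∈ supportSubgroup Q A, ∀ i < n, T (x i) = y i := by
  induction n with
  | zero => exact ⟨1, one_mem _, fun i hi => absurd hi (Nat.not_lt_zero i)⟩
  | succ n ih =>
    obtain ⟨T, hT, hTx⟩ := ih (fun i hi => hx i (by omega)) (fun i hi => hy i (by omega))
      fun i hi j hj => hxy i (by omega) j (by omega)
    -- The reflection corrects the last vector and fixes each earlier `y i`, which has the same
    -- inner product with `T (x n)` as with `y n`.
    obtain ⟨R, hR, hRx, hRz⟩ := exists_reflection hQ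
      (supportedIn_of_mem hT subset_rfl (hx n n.lt_succ_self)) (hy n n.lt_succ_self)
      (by rw [inner_map_map, hxy n n.lt_succ_self n n.lt_succ_self])
    refine ⟨R * T, mul_mem hR hT, fun i hi => ?_⟩
    rw [mul_apply]
    rcases Nat.lt_succ_iff_lt_or_eq.1 hi with h | rfl
    · rw [hTx i h, hRz]
      rw [← hTx i h, inner_map_map, hTx i h, hxy n n.lt_succ_self i hi]
    · exact hRx

/-- On finitely many basis vectors, an isometry agrees with one of finite support. -/
theorem exists_finite_support (hQ : ∀ z ∈ Q, conj z ∈ Q) (T : UnitaryV Q) (L : ℕ) :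
    ∃ K, ∀ M, K ≤ M → ∃ U ∈ supportSubgroup Q (Iio M), ∀ j < L, U (basis Q j) = T (basis Q j) := by
  obtain ⟨K, hK⟩ := exists_supportedIn_Iio_of_finite fun i : Fin L => T (basis Q i)
  refine ⟨max K L, fun M hM => ?_⟩
  refine exists_map_eq_of_inner_eq hQ (fun i hi => .basis ?_) (fun i hi => ?_) fun i _ j _ => ?_
  · exact hi.trans_le ((le_max_right _ _).trans hM)
  · exact hK M ((le_max_left _ _).trans hM) ⟨i, hi⟩
  · rw [inner_map_map]

/-- Columns from different fibers are orthogonal since their supports are disjoint; gluing the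
inverses in the same way supplies the adjoint matrix. -/
theorem exists_glue_fibers {ι : Type*} (p : ℕ → ι) {T : ι → UnitaryV Q}
    (hT : ∀ i, T i ∈ supportSubgroup Q (p ⁻¹' {i})) :
    ∃ S : UnitaryV Q, ∀ j, S (basis Q j) = T (p j) (basis Q j) := by
  have hsupp : ∀ T : ι → UnitaryV Q, (∀ i, T i ∈ supportSubgroup Q (p ⁻¹' {i})) → ∀ j,
      SupportedIn (p ⁻¹' {p j}) (T (p j) (basis Q j)) := fun T hT j =>
    supportedIn_of_mem (hT _) subset_rfl (.basis rfl)
  have hdisj : ∀ {j k}, p j ≠ p k → Disjoint (p ⁻¹' {p j}) (p ⁻¹' {p k}) := fun h =>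
    Disjoint.preimage _ (Set.disjoint_singleton.2 h)
  have hortho : ∀ T : ι → UnitaryV Q, (∀ i, T i ∈ supportSubgroup Q (p ⁻¹' {i})) →
      Orthonormal ℂ fun j => (T (p j) (basis Q j) : EllTwo) := by
    refine fun T hT => orthonormal_iff_ite.2 fun j k => ?_
    by_cases h : p j = p k
    · rw [h, inner_map_map, coe_basis, coe_basis,
        orthonormal_iff_ite.1 EllTwo.orthonormal_basis]
    · rw [(hsupp T hT j).inner_eq_zero (hdisj h) (hsupp T hT k), if_neg]
      rintro rfl
      exact h rfl
  have hT' : ∀ i, (T i)⁻¹ ∈ supportSubgroup Q (p ⁻¹' {i}) := fun i => inv_mem (hT i)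
  obtain ⟨S, hS, -⟩ := exists_of_adjoint (hortho T hT) (hortho (fun i => (T i)⁻¹) hT')
    fun j k => by
      rw [← coe_basis (Q := Q), ← coe_basis (Q := Q)]
      by_cases h : p j = p k
      · rw [h, inner_map_left]
      · rw [(hsupp T hT j).inner_eq_zero (hdisj h) (.basis rfl),
          SupportedIn.inner_eq_zero (hdisj h) (.basis rfl) (hsupp _ hT' k)]
  exact ⟨S, hS⟩

/-- Isometries with pairwise disjoint supports have a common direct sum. -/
theorem exists_glue {ι : Type*} {A : ι → Set ℕ} (hA : Pairwise (Function.onFun Disjoint A))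
    {T : ι → UnitaryV Q} (hT : ∀ i, T i ∈ supportSubgroup Q (A i)) :
    ∃ S ∈ supportSubgroup Q (⋃ i, A i), ∀ i, ∀ j ∈ A i, S (basis Q j) = T i (basis Q j) := by
  classical
  -- The label `none` marks the indices outside every `A i`, where the identity is glued in.
  obtain ⟨p, hp⟩ : ∃ p : ℕ → Option ι, ∀ i j, p j = some i ↔ j ∈ A i := by
    refine ⟨fun j => if h : ∃ i, j ∈ A i then some h.choose else none, fun i j => ?_⟩
    dsimp only
    split_ifs with h
    · rw [Option.some_inj]
      refine ⟨fun hi => hi ▸ h.choose_spec, fun hj => ?_⟩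
      by_contra hne
      exact Set.disjoint_left.1 (hA hne) h.choose_spec hj
    · simpa using fun hj => h ⟨i, hj⟩
  obtain ⟨S, hS⟩ := exists_glue_fibers p (T := fun o => o.elim 1 T) (by
    rintro (_ | i)
    · exact one_mem _
    · exact supportSubgroup_mono (fun j hj => (hp i j).2 hj) (hT i))
  refine ⟨S, fun j hj => ?_, fun i j hj => ?_⟩
  · rw [hS]
    rcases hpj : p j with _ | i
    · rfl
    · exact absurd (mem_iUnion.2 ⟨i, (hp i j).1 hpj⟩) hj
  · rw [hS, (hp i j).2 hj]
    rfl

end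

/-- The isometries permuting the basis. -/
theorem exists_perm (σ : Equiv.Perm ℕ) :
    ∃ T : UnitaryV Q, ∀ i, T (basis Q i) = basis Q (σ i) := by
  have h : ∀ σ : Equiv.Perm ℕ, Orthonormal ℂ fun i => (basis Q (σ i) : EllTwo) := fun σ => by
    simp only [coe_basis]
    exact EllTwo.orthonormal_basis.comp σ σ.injective
  obtain ⟨T, hT, -⟩ := exists_of_adjoint (h σ) (h σ⁻¹) fun i j => by
    rw [coe_basis, coe_basis, orthonormal_iff_ite.1 EllTwo.orthonormal_basis,
      orthonormal_iff_ite.1 EllTwo.orthonormal_basis]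
    exact if_congr (by rw [Equiv.Perm.eq_inv_iff_eq]) rfl rfl
  exact ⟨T, hT⟩

/-- The action of the permutations of `ℕ` by permuting the basis. -/
noncomputable def permHom (Q : Subfield ℂ) : Equiv.Perm ℕ →* UnitaryV Q where
  toFun σ := (exists_perm σ).choose
  map_one' := ext_basis fun i => (exists_perm (Q := Q) 1).choose_spec i
  map_mul' σ τ := ext_basis fun i => by
    rw [mul_apply, (exists_perm (Q := Q) (σ * τ)).choose_spec,
      (exists_perm (Q := Q) τ).choose_spec, (exists_perm (Q := Q) σ).choose_spec]
    rfl

@[simp] theorem permHom_basis (σ : Equiv.Perm ℕ) (i : ℕ) :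
    permHom Q σ (basis Q i) = basis Q (σ i) :=
  (exists_perm (Q := Q) σ).choose_spec i

theorem permHom_conj_mem {A : Set ℕ} {T : UnitaryV Q} (hT : T ∈ supportSubgroup Q A)
    (σ : Equiv.Perm ℕ) : permHom Q σ * T * (permHom Q σ)⁻¹ ∈ supportSubgroup Q (σ '' A) := by
  intro j hj
  have hσ : σ (σ⁻¹ j) = j := σ.apply_symm_apply j
  rw [← map_inv, mul_apply, mul_apply, permHom_basis, hT, permHom_basis, hσ]
  exact fun h => hj ⟨_, h, hσ⟩

theorem permHom_mem {A : Set ℕ} {σ : Equiv.Perm ℕ} (h : ∀ j, j ∉ A → σ j = j) :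
    permHom Q σ ∈ supportSubgroup Q A := fun j hj => by
  rw [permHom_basis, h j hj]

end UnitaryV

/-! ### The permutation group topology -/

/-- The `Q`-span of the basis, taken as a discrete set. -/
def DiscreteRatSpan (Q : Subfield ℂ) : Type := ratSpan Q

instance (Q : Subfield ℂ) : TopologicalSpace (DiscreteRatSpan Q) := ⊥

instance (Q : Subfield ℂ) : DiscreteTopology (DiscreteRatSpan Q) := ⟨rfl⟩

instance (Q : Subfield ℂ) [Countable Q] : Countable (DiscreteRatSpan Q) :=
  inferInstanceAs (Countable (ratSpan Q))

/-- A vector of the `Q`-span as a point of the discrete space. -/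
def DiscreteRatSpan.of {Q : Subfield ℂ} (x : ratSpan Q) : DiscreteRatSpan Q := x

/-- A point of the discrete space as a vector of `ℓ₂`. -/
noncomputable def DiscreteRatSpan.toEllTwo {Q : Subfield ℂ} (x : DiscreteRatSpan Q) : EllTwo :=
  Subtype.val (p := (· ∈ ratSpan Q)) x

open DiscreteRatSpan

namespace UnitaryV

open ratSpan

variable {Q : Subfield ℂ}

theorem isInducing_eval : Topology.IsInducing
    fun (T : UnitaryV Q) (x : ratSpan Q) => of (T x) := ⟨rfl⟩

theorem tendsto_nhds {α : Type*} {l : Filter α} {F : α → UnitaryV Q} {T : UnitaryV Q} :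
    Tendsto F l (𝓝 T) ↔ ∀ x, ∀ᶠ a in l, F a x = T x := by
  rw [isInducing_eval.tendsto_nhds_iff, tendsto_pi_nhds]
  simp only [nhds_discrete, tendsto_pure, Function.comp_apply]
  rfl

theorem tendsto_nhds_iff_basis {α : Type*} {l : Filter α} {F : α → UnitaryV Q} {T : UnitaryV Q} :
    Tendsto F l (𝓝 T) ↔ ∀ i, ∀ᶠ a in l, F a (basis Q i) = T (basis Q i) := by
  rw [tendsto_nhds]
  refine ⟨fun h i => h _, fun h x => ?_⟩
  obtain ⟨K, hK⟩ := exists_supportedIn_Iio x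
  filter_upwards [(Set.finite_Iio K).eventually_all.2 fun i _ => h i] with a ha
  exact apply_eq_of_supportedIn ha (hK K le_rfl)

theorem isOpen_setOf_apply_eq (x y : ratSpan Q) : IsOpen {T : UnitaryV Q | T x = y} := by
  rw [isOpen_iff_mem_nhds]
  rintro T rfl
  exact tendsto_nhds.1 (tendsto_id (x := 𝓝 T)) x

theorem isOpen_setOf_apply_mem (x : ratSpan Q) (s : Set (ratSpan Q)) :
    IsOpen {T : UnitaryV Q | T x ∈ s} := by
  have : {T : UnitaryV Q | T x ∈ s} = ⋃ y ∈ s, {T : UnitaryV Q | T x = y} := by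
    ext T
    simp
  rw [this]
  exact isOpen_biUnion fun y _ => isOpen_setOf_apply_eq x y

theorem nhds_hasBasis (T : UnitaryV Q) :
    (𝓝 T).HasBasis (fun _ : ℕ => True)
      fun K => {S | ∀ j < K, S (basis Q j) = T (basis Q j)} := by
  have hb : (⨅ K : ℕ, 𝓟 {S : UnitaryV Q | ∀ j < K, S (basis Q j) = T (basis Q j)}).HasBasis
      (fun _ : ℕ => True) fun K => {S | ∀ j < K, S (basis Q j) = T (basis Q j)} :=
    hasBasis_iInf_principal
      (directed_of_isDirected_le fun K L hKL S hS j hj => hS j (hj.trans_le hKL))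
  convert hb
  refine le_antisymm (le_iInf fun K => le_principal_iff.2 ?_) (tendsto_id'.1 ?_)
  · exact (Set.finite_Iio K).eventually_all.2 fun i _ =>
      (isOpen_setOf_apply_eq _ _).mem_nhds rfl
  · rw [tendsto_nhds_iff_basis]
    intro i
    exact hb.mem_iff.2 ⟨i + 1, trivial, fun S hS => hS i i.lt_succ_self⟩

instance instIsTopologicalGroup : IsTopologicalGroup (UnitaryV Q) where
  continuous_mul := by
    rw [continuous_iff_continuousAt]
    rintro ⟨S, T⟩
    refine tendsto_nhds.2 fun x => ?_
    have h : {p : UnitaryV Q × UnitaryV Q | p.1 (T x) = S (T x) ∧ p.2 x = T x} ∈ 𝓝 (S, T) :=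
      (((isOpen_setOf_apply_eq (T x) (S (T x))).preimage continuous_fst).inter
        ((isOpen_setOf_apply_eq x (T x)).preimage continuous_snd)).mem_nhds ⟨rfl, rfl⟩
    filter_upwards [h] with p hp
    rw [mul_apply, mul_apply, hp.2, hp.1]
  continuous_inv := by
    rw [continuous_iff_continuousAt]
    intro T
    refine tendsto_nhds.2 fun x => ?_
    filter_upwards [(isOpen_setOf_apply_eq (T⁻¹ x) x).mem_nhds (apply_inv_self T x)] with S hS
    exact inv_apply_eq_iff.2 (Eq.symm hS)

/-- The columns of an isometry and of its inverse. -/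
noncomputable def columns (T : UnitaryV Q) :
    (ℕ → DiscreteRatSpan Q) × (ℕ → DiscreteRatSpan Q) :=
  (fun i => of (T (basis Q i)), fun i => of (T⁻¹ (basis Q i)))

theorem continuous_columns : Continuous (columns (Q := Q)) := by
  have h : ∀ x : ratSpan Q, Continuous fun T : UnitaryV Q => of (T x) := fun x =>
    (continuous_apply x).comp isInducing_eval.continuous
  exact (continuous_pi fun i => h _).prodMk (continuous_pi fun i => (h _).comp continuous_inv)

theorem isInducing_columns : Topology.IsInducing (columns (Q := Q)) := by
  rw [Topology.isInducing_iff_nhds]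
  intro T
  refine le_antisymm (map_le_iff_le_comap.1 (continuous_columns.tendsto T)) ?_
  refine tendsto_id'.1 (tendsto_nhds_iff_basis.2 fun i => ?_)
  have h : Continuous fun p : (ℕ → DiscreteRatSpan Q) × (ℕ → DiscreteRatSpan Q) => p.1 i := by
    fun_prop
  have := (h.tendsto (columns T)).comp (tendsto_comap (f := columns))
  rw [nhds_discrete (DiscreteRatSpan Q), tendsto_pure] at this
  exact this

theorem range_columns [IsAlgClosed Q] : range (columns (Q := Q)) =
    {p | (∀ i j, ⟪(p.1 i).toEllTwo, (p.1 j).toEllTwo⟫ = if i = j then 1 else 0) ∧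
      (∀ i j, ⟪(p.2 i).toEllTwo, (p.2 j).toEllTwo⟫ = if i = j then 1 else 0) ∧
      ∀ i j, ⟪(p.1 i).toEllTwo, ellTwoBasis j⟫ = ⟪ellTwoBasis i, (p.2 j).toEllTwo⟫} := by
  ext ⟨x, y⟩
  constructor
  · rintro ⟨T, hT⟩
    obtain ⟨rfl, rfl⟩ := Prod.mk.inj hT
    exact ⟨orthonormal_iff_ite.1 T.orthonormal_map_basis,
      orthonormal_iff_ite.1 T⁻¹.orthonormal_map_basis, fun i j => by
        rw [← coe_basis (Q := Q), ← coe_basis (Q := Q)]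
        exact inner_map_left T _ _⟩
  · rintro ⟨hx, hy, hxy⟩
    obtain ⟨T, h1, h2⟩ := exists_of_adjoint (x := x) (y := y)
      (orthonormal_iff_ite.2 hx) (orthonormal_iff_ite.2 hy) hxy
    exact ⟨T, Prod.ext (funext h1) (funext h2)⟩

theorem isClosedEmbedding_columns [IsAlgClosed Q] :
    Topology.IsClosedEmbedding (columns (Q := Q)) := by
  refine ⟨⟨isInducing_columns, fun S T h => ext_basis (congr_fun (congr_arg Prod.fst h))⟩, ?_⟩
  rw [range_columns]
  have h : Continuous (toEllTwo (Q := Q)) := continuous_of_discreteTopology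
  have h1 : ∀ i, Continuous fun p : (ℕ → DiscreteRatSpan Q) × (ℕ → DiscreteRatSpan Q) =>
      (p.1 i).toEllTwo := fun i => h.comp (by fun_prop)
  have h2 : ∀ i, Continuous fun p : (ℕ → DiscreteRatSpan Q) × (ℕ → DiscreteRatSpan Q) =>
      (p.2 i).toEllTwo := fun i => h.comp (by fun_prop)
  simp only [ofPred_and, ofPred_forall]
  refine IsClosed.inter ?_ (IsClosed.inter ?_ ?_) <;>
  refine isClosed_iInter fun i => isClosed_iInter fun j => isClosed_eq ?_ ?_
  · exact (h1 i).inner (h1 j)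
  · exact continuous_const
  · exact (h2 i).inner (h2 j)
  · exact continuous_const
  · exact (h1 i).inner continuous_const
  · exact continuous_const.inner (h2 j)

variable [IsAlgClosed Q] [Countable Q]

instance instPolishSpace : PolishSpace (UnitaryV Q) := by
  have : PolishSpace (DiscreteRatSpan Q) := inferInstance
  exact isClosedEmbedding_columns.polishSpace

theorem isPolishGroup : IsPolishGroup (UnitaryV Q) :=
  ⟨inferInstance, inferInstance⟩

end UnitaryV

/-! ### Extension to `ℓ₂` and density -/

namespace ratSpan

variable {Q : Subfield ℂ} [IsAlgClosed Q]

theorem dense_subfield (Q : Subfield ℂ) [IsAlgClosed Q] : Dense (Q : Set ℂ) := by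
  have h : DenseRange fun p : ℚ × ℚ => Complex.equivRealProdCLM.symm ((p.1 : ℝ), (p.2 : ℝ)) :=
    Complex.equivRealProdCLM.symm.surjective.denseRange.comp
      (Rat.denseRange_cast.prodMap Rat.denseRange_cast) Complex.equivRealProdCLM.symm.continuous
  refine h.mono ?_
  rintro _ ⟨⟨a, b⟩, rfl⟩
  have : Complex.equivRealProdCLM.symm ((a : ℝ), (b : ℝ)) = (a : ℂ) + (b : ℂ) * Complex.I := by
    simp [Complex.ext_iff]
  simp only [this]
  exact Q.add_mem (SubfieldClass.ratCast_mem Q a)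
    (Q.mul_mem (SubfieldClass.ratCast_mem Q b) Q.I_mem_of_isAlgClosed)

theorem dense : Dense (ratSpan Q : Set EllTwo) := by
  have hsmul : ∀ (c : ℂ) (i : ℕ),
      c • ellTwoBasis i ∈ (ratSpan Q).toAddSubgroup.topologicalClosure := by
    intro c i
    have h : Continuous fun c : ℂ => c • ellTwoBasis i := by fun_prop
    exact map_mem_closure (f := fun c : ℂ => c • ellTwoBasis i) h (dense_subfield Q c) fun q hq =>
      Submodule.smul_mem _ (⟨q, hq⟩ : Q) (Submodule.subset_span ⟨i, rfl⟩)
  intro x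
  have := mem_closure_of_tendsto (EllTwo.hasSum_basis x) (Eventually.of_forall fun s =>
    AddSubgroup.sum_mem (ratSpan Q).toAddSubgroup.topologicalClosure fun i _ => hsmul (x i) i)
  rwa [(AddSubgroup.isClosed_topologicalClosure _).closure_eq] at this

/-- The norm lies in `Q` because its square does. For `w = 0` the convention `0⁻¹ = 0` yields the
zero vector; the Gram-Schmidt step avoids this case for large indices. -/
theorem exists_normalize (hQ : ∀ z ∈ Q, conj z ∈ Q) (w : ratSpan Q) :
    ∃ z : ratSpan Q, (z : EllTwo) = ((‖(w : EllTwo)‖ : ℂ))⁻¹ • (w : EllTwo) := by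
  have h : (‖(w : EllTwo)‖ : ℂ) ∈ Q := by
    refine Q.ofReal_mem_of_sq_mem ?_
    have := inner_mem hQ w w
    rwa [inner_self_eq_norm_sq_to_K] at this
  exact ⟨(⟨_, Q.inv_mem h⟩ : Q) • w, rfl⟩

/-- Finite orthonormal families of `ℓ₂` are limits of orthonormal families of the `Q`-span. -/
theorem exists_tendsto_orthonormal (hQ : ∀ z ∈ Q, conj z ∈ Q) {u : ℕ → EllTwo}
    (hu : Orthonormal ℂ u) (n : ℕ) :
    ∃ v : ℕ → ℕ → ratSpan Q,
      (∀ i < n, Tendsto (fun k => (v k i : EllTwo)) atTop (𝓝 (u i))) ∧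
      ∀ᶠ k in atTop, ∀ i < n, ∀ j < n,
        ⟪(v k i : EllTwo), (v k j : EllTwo)⟫ = if i = j then 1 else 0 := by
  induction n with
  | zero => exact ⟨0, by simp, by simp⟩
  | succ n ih =>
    obtain ⟨v, hv, hvo⟩ := ih
    obtain ⟨w, hwV, hw⟩ := mem_closure_iff_seq_limit.1 (dense (Q := Q) (u n))
    -- Gram-Schmidt within the `Q`-span: the subtracted projection tends to `0`, since `u n` is
    -- orthogonal to the earlier `u i`.
    have hw'V : ∀ k, w k - ∑ i ∈ Finset.range n, ⟪(v k i : EllTwo), w k⟫ • (v k i : EllTwo) ∈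
        ratSpan Q := fun k =>
      Submodule.sub_mem _ (hwV k) (Submodule.sum_mem _ fun i _ =>
        Submodule.smul_mem _ (⟨_, inner_mem hQ (v k i) ⟨w k, hwV k⟩⟩ : Q) (v k i).2)
    obtain ⟨w', hw'⟩ : ∃ w' : ℕ → ratSpan Q, ∀ k, (w' k : EllTwo) =
        w k - ∑ i ∈ Finset.range n, ⟪(v k i : EllTwo), w k⟫ • (v k i : EllTwo) :=
      ⟨fun k => ⟨_, hw'V k⟩, fun k => rfl⟩
    have hlim : Tendsto (fun k => (w' k : EllTwo)) atTop (𝓝 (u n)) := by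
      have h1 : Tendsto (fun k => w k - ∑ i ∈ Finset.range n,
          ⟪(v k i : EllTwo), w k⟫ • (v k i : EllTwo)) atTop
          (𝓝 (u n - ∑ i ∈ Finset.range n, ⟪u i, u n⟫ • u i)) :=
        hw.sub (tendsto_finsetSum _ fun i hi =>
          ((hv i (Finset.mem_range.1 hi)).inner hw).smul (hv i (Finset.mem_range.1 hi)))
      rw [Finset.sum_eq_zero, sub_zero] at h1
      · exact h1.congr fun k => (hw' k).symm
      · intro i hi
        rw [orthonormal_iff_ite.1 hu, if_neg (Finset.mem_range.1 hi).ne, zero_smul]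
    choose z hz using fun k => exists_normalize hQ (w' k)
    have hnorm : Tendsto (fun k => (‖(w' k : EllTwo)‖ : ℂ)) atTop (𝓝 1) := by
      have h1 := (Complex.continuous_ofReal.tendsto _).comp hlim.norm
      rwa [hu.1 n, Complex.ofReal_one] at h1
    have hzlim : Tendsto (fun k => (z k : EllTwo)) atTop (𝓝 (u n)) := by
      have h1 := (hnorm.inv₀ one_ne_zero).smul hlim
      rw [inv_one, one_smul] at h1
      exact h1.congr fun k => (hz k).symm
    refine ⟨fun k i => if i < n then v k i else z k, fun i hi => ?_, ?_⟩
    · rcases Nat.lt_succ_iff_lt_or_eq.1 hi with h | rfl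
      · simpa only [if_pos h] using hv i h
      · simpa only [lt_irrefl, if_false] using hzlim
    · filter_upwards [hvo, hnorm.eventually_ne one_ne_zero] with k hk hk0 i hi j hj
      have hzz : ⟪(z k : EllTwo), (z k : EllTwo)⟫ = 1 := by
        rw [hz, inner_smul_left, inner_smul_right, inner_self_eq_norm_sq_to_K, map_inv₀,
          Complex.conj_ofReal]
        change _ * (_ * (‖(w' k : EllTwo)‖ : ℂ) ^ 2) = 1
        field_simp
      have hvz : ∀ i < n, ⟪(v k i : EllTwo), (z k : EllTwo)⟫ = 0 := by
        intro i hi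
        have hs : ⟪(v k i : EllTwo), ∑ j ∈ Finset.range n,
            ⟪(v k j : EllTwo), w k⟫ • (v k j : EllTwo)⟫ = ⟪(v k i : EllTwo), w k⟫ := by
          rw [inner_sum, Finset.sum_eq_single i]
          · rw [inner_smul_right, hk i hi i hi, if_pos rfl, mul_one]
          · intro j hj hji
            rw [inner_smul_right, hk i hi j (Finset.mem_range.1 hj), if_neg hji.symm, mul_zero]
          · exact fun h => absurd (Finset.mem_range.2 hi) h
        rw [hz, inner_smul_right, hw', inner_sub_right, hs, sub_self, mul_zero]
      rcases Nat.lt_succ_iff_lt_or_eq.1 hi with h | rfl <;>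
      rcases Nat.lt_succ_iff_lt_or_eq.1 hj with h' | rfl
      · simp only [if_pos h, if_pos h', hk i h j h']
      · simp only [if_pos h, lt_irrefl, if_false, hvz i h, if_neg h.ne]
      · simp only [if_pos h', lt_irrefl, if_false, if_neg h'.ne']
        rw [← inner_conj_symm, hvz j h', map_zero]
      · simp only [lt_irrefl, if_false, if_true, hzz]

end ratSpan

namespace UnitaryV

open ratSpan

variable {Q : Subfield ℂ} [IsAlgClosed Q]

theorem existsUnique_extends (T : UnitaryV Q) : ∃! S : UnitaryEllTwo, Extends S T := by
  obtain ⟨S, hS⟩ := T.exists_extends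
  exact ⟨S, hS, fun S' hS' => extends_unique hS' hS⟩

/-- The extension of isometries of the `Q`-span to unitary operators of `ℓ₂`. -/
noncomputable def extendHom (Q : Subfield ℂ) [IsAlgClosed Q] : UnitaryV Q →* UnitaryEllTwo where
  toFun T := T.exists_extends.choose
  map_one' := extends_unique (T := 1) (exists_extends _).choose_spec fun _ => rfl
  map_mul' S T := extends_unique (T := S * T) (exists_extends _).choose_spec fun x => by
    rw [UnitaryEllTwo.mul_apply, T.exists_extends.choose_spec, S.exists_extends.choose_spec,
      mul_apply]

theorem extends_extendHom (T : UnitaryV Q) : Extends (extendHom Q T) T :=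
  T.exists_extends.choose_spec

theorem continuous_extendHom : Continuous (extendHom Q) := by
  rw [continuous_iff_continuousAt]
  refine fun T => UnitaryEllTwo.tendsto_of_basis fun i => ?_
  refine tendsto_const_nhds.congr' ?_
  filter_upwards [(isOpen_setOf_apply_eq (basis Q i) (T (basis Q i))).mem_nhds rfl] with S hS
  rw [← coe_basis (Q := Q), extends_extendHom, extends_extendHom, hS]

/-- The first `n` columns of `S` are approximated by an exactly orthonormal family in the `Q`-span,
and Witt's theorem turns that family into columns of an isometry. -/
theorem denseRange_extendHom (hQ : ∀ z ∈ Q, conj z ∈ Q) : DenseRange (extendHom Q) := by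
  intro S
  have key : ∀ n : ℕ, ∃ T : UnitaryV Q, ∀ i < n,
      dist (extendHom Q T (ellTwoBasis i)) (S (ellTwoBasis i)) < 1 / ((n : ℝ) + 1) := by
    intro n
    have hS : Orthonormal ℂ fun i => S (ellTwoBasis i) := by
      simp only [orthonormal_iff_ite, UnitaryEllTwo.inner_map_map,
        orthonormal_iff_ite.1 EllTwo.orthonormal_basis, implies_true]
    obtain ⟨v, hv, hvo⟩ := exists_tendsto_orthonormal hQ hS n
    obtain ⟨k, hk, hkd⟩ := (hvo.and ((Set.finite_Iio n).eventually_all.2 fun i hi =>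
      Metric.tendsto_nhds.1 (hv i hi) (1 / ((n : ℝ) + 1)) (by positivity))).exists
    obtain ⟨T, -, hT⟩ := exists_map_eq_of_inner_eq hQ (A := univ) (x := fun i => basis Q i)
      (y := v k) (n := n) (fun _ _ j hj => (hj trivial).elim) (fun _ _ j hj => (hj trivial).elim)
      fun i hi j hj => by
        rw [hk i hi j hj, coe_basis, coe_basis, orthonormal_iff_ite.1 EllTwo.orthonormal_basis]
    refine ⟨T, fun i hi => ?_⟩
    rw [← coe_basis (Q := Q), extends_extendHom, hT i hi, coe_basis]
    exact hkd i hi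
  choose T hT using key
  refine mem_closure_of_tendsto (f := fun n => extendHom Q (T n)) (b := atTop)
    (UnitaryEllTwo.tendsto_of_basis fun i => ?_) (Eventually.of_forall fun n => mem_range_self _)
  rw [tendsto_iff_dist_tendsto_zero]
  refine squeeze_zero' (Eventually.of_forall fun _ => dist_nonneg) ?_
    tendsto_one_div_add_atTop_nhds_zero_nat
  filter_upwards [eventually_gt_atTop i] with n hn
  exact (hT n i hn).le

theorem dense_setOf_extends (hQ : ∀ z ∈ Q, conj z ∈ Q) :
    Dense {S : UnitaryEllTwo | ∃ T : UnitaryV Q, Extends S T} := by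
  refine (denseRange_extendHom hQ).mono ?_
  rintro _ ⟨T, rfl⟩
  exact ⟨T, extends_extendHom T⟩

end UnitaryV

/-- Boundedness of orbits passes from a group with the Bergman property to a topological group in
which it has dense image. -/
theorem HasBergmanProperty.hasPropertyOB {G : Type*} {H : Type*} [Group G] [Group H]
    [TopologicalSpace H] (hG : HasBergmanProperty G) {f : G →* H} (hf : DenseRange f) :
    HasPropertyOB.{_, v} H := by
  intro X _ _ hiso hcont x
  -- Displacement of `x` is subadditive for an action by isometries, so a `k`-th power of the `n`-th
  -- sublevel set has displacement at most `k * n`; continuity then carries the bound from the dense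
  -- image to all of `H`.
  obtain ⟨n, k, hnk⟩ := hG (fun n => {g : G | dist (f g • x) x ≤ n})
    (fun m n hmn g hg => le_trans (α := ℝ) hg (by exact_mod_cast hmn))
    (eq_univ_of_forall fun g =>
      let ⟨n, hn⟩ := exists_nat_ge (dist (f g • x) x)
      mem_iUnion.2 ⟨n, hn⟩)
  have hpow : ∀ k : ℕ, ∀ g ∈ {g : G | dist (f g • x) x ≤ n} ^ k, dist (f g • x) x ≤ k * n := by
    intro k
    induction k with
    | zero =>
      intro g hg
      rw [pow_zero, Set.mem_one] at hg
      simp [hg]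
    | succ k ih =>
      intro g hg
      rw [pow_succ'] at hg
      obtain ⟨a, ha, b, hb, rfl⟩ := Set.mem_mul.1 hg
      have h1 := dist_triangle (f (a * b) • x) (f a • x) x
      rw [map_mul, mul_smul, (hiso (f a)).dist_eq] at h1
      have h2 := ih b hb
      have h3 : dist (f a • x) x ≤ n := ha
      rw [map_mul, mul_smul]
      push_cast
      linarith
  have hall : ∀ h : H, dist (h • x) x ≤ k * n := by
    have hclosed : IsClosed {h : H | dist (h • x) x ≤ k * n} :=
      isClosed_le ((hcont x).dist continuous_const) continuous_const
    intro h
    refine hclosed.closure_subset_iff.2 ?_ (hf h)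
    rintro _ ⟨g, rfl⟩
    exact hpow k g (hnk ▸ mem_univ g)
  refine (Metric.isBounded_closedBall (x := x) (r := k * n)).subset ?_
  rintro _ ⟨h, rfl⟩
  exact hall h

/-- Applying `f` coordinatewise is continuous with dense range and commutes with conjugation, so it
maps the dense orbit to a dense orbit. -/
theorem HasAmpleCyclicallyDenseConjClass.map {G : Type*} {H : Type*} [Group G] [Group H]
    [TopologicalSpace G] [TopologicalSpace H] (hG : HasAmpleCyclicallyDenseConjClass G)
    (hH : IsPolishGroup H) {f : G →* H} (hfc : Continuous f) (hf : DenseRange f) :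
    HasAmpleCyclicallyDenseConjClass H := by
  obtain ⟨-, g, h, hgh⟩ := hG
  refine ⟨hH, f g, fun k => f (h k), ?_⟩
  have hF : Continuous fun (x : ℕ → G) (k : ℕ) => f (x k) := by fun_prop
  have hFd : DenseRange fun (x : ℕ → G) (k : ℕ) => f (x k) := DenseRange.piMap fun _ => hf
  refine (hFd.dense_image hF hgh).mono ?_
  rintro _ ⟨_, ⟨n, rfl⟩, rfl⟩
  exact ⟨n, by simp⟩

/-! ### Permutations of `ℕ` with prescribed behaviour on infinite pieces -/

/-- Labellings of `ℕ` with infinite fibers are conjugate by a permutation, which can be taken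
to be trivial where the fibers coincide. -/
theorem exists_perm_of_infinite_fibers {ι : Type*} {p q : ℕ → ι} (S : Set ι)
    (hp : ∀ i, i ∉ S → (p ⁻¹' {i}).Infinite) (hq : ∀ i, i ∉ S → (q ⁻¹' {i}).Infinite)
    (hpq : ∀ x, p x ∈ S ∨ q x ∈ S → p x = q x) :
    ∃ σ : Equiv.Perm ℕ, (∀ x, q (σ x) = p x) ∧ ∀ x, p x ∈ S → σ x = x := by
  -- For a label in `S` the two fibers are the same set and the identity is used; otherwise both are
  -- countably infinite.
  have key : ∀ i, ∃ e : {x // p x = i} ≃ {x // q x = i}, i ∈ S → ∀ x, (e x : ℕ) = x := by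
    intro i
    by_cases hi : i ∈ S
    · refine ⟨Equiv.subtypeEquivRight fun x => ⟨fun h => ?_, fun h => ?_⟩, fun _ _ => rfl⟩
      · rw [← hpq x (Or.inl (h ▸ hi)), h]
      · rw [hpq x (Or.inr (h ▸ hi)), h]
    · have h1 : Infinite {x // p x = i} := (hp i hi).to_subtype
      have h2 : Infinite {x // q x = i} := (hq i hi).to_subtype
      obtain ⟨e⟩ := nonempty_equiv_of_countable (α := {x // p x = i}) (β := {x // q x = i})
      exact ⟨e, fun h => absurd h hi⟩
  choose e he using key
  refine ⟨(Equiv.sigmaFiberEquiv p).symm.trans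
    ((Equiv.sigmaCongrRight e).trans (Equiv.sigmaFiberEquiv q)), fun x => ?_, fun x hx => ?_⟩
  · exact (e (p x) ⟨x, rfl⟩).2
  · exact he (p x) hx ⟨x, rfl⟩

/-- The labellings `p` and `π⁻¹ ∘ p` are compared; their fibers coincide over the fixed points of
`π`. -/
theorem exists_perm_lift {ι : Type*} {p : ℕ → ι} (hp : ∀ i, (p ⁻¹' {i}).Infinite)
    (π : Equiv.Perm ι) :
    ∃ σ : Equiv.Perm ℕ, (∀ x, p (σ x) = π (p x)) ∧ ∀ x, π (p x) = p x → σ x = x := by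
  have hq : ∀ i, i ∉ {i | π i = i} → ((fun x => π.symm (p x)) ⁻¹' {i}).Infinite := fun i _ => by
    convert hp (π i) using 1
    ext x
    simp [Equiv.symm_apply_eq]
  obtain ⟨σ, h1, h2⟩ := exists_perm_of_infinite_fibers (p := p) (q := fun x => π.symm (p x))
    {i | π i = i} (fun i _ => hp i) hq fun x hx => by
      rw [Equiv.eq_symm_apply]
      rcases hx with hx | hx
      · exact hx
      · have h : π (π.symm (p x)) = π.symm (p x) := hx
        rw [Equiv.apply_symm_apply] at h
        conv_lhs => rw [h, Equiv.apply_symm_apply]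
  exact ⟨σ, fun x => by rw [← h1 x, Equiv.apply_symm_apply], h2⟩

/-- An infinite set of natural numbers splits into infinite pieces indexed by `ι`. -/
theorem Set.Infinite.exists_label {s : Set ℕ} (hs : s.Infinite) (ι : Type*) [Countable ι]
    [Nonempty ι] : ∃ r : ℕ → ι, ∀ i, {j | j ∈ s ∧ r j = i}.Infinite := by
  classical
  have : Infinite s := hs.to_subtype
  obtain ⟨e⟩ := nonempty_equiv_of_countable (α := s) (β := ι × ℕ)
  refine ⟨fun j => if h : j ∈ s then (e ⟨j, h⟩).1 else Classical.arbitrary ι, fun i => ?_⟩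
  have hinj : Function.Injective fun n : ℕ => (e.symm (i, n) : ℕ) := fun m n h => by
    simpa using Subtype.ext h
  refine (infinite_range_of_injective hinj).mono ?_
  rintro _ ⟨n, rfl⟩
  refine ⟨(e.symm (i, n)).2, ?_⟩
  simp

/-! ### The Bergman property -/

/-- The set `s` is contained in a power of a member of the sequence `W`. -/
def IsBoundedFor {G : Type*} [Group G] (W : ℕ → Set G) (s : Set G) : Prop :=
  ∃ n k : ℕ, s ⊆ W n ^ k

namespace IsBoundedFor

variable {G : Type*} [Group G] {W : ℕ → Set G} {s t : Set G}

theorem subset (ht : IsBoundedFor W t) (h : s ⊆ t) : IsBoundedFor W s :=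
  let ⟨n, k, hnk⟩ := ht
  ⟨n, k, h.trans hnk⟩

theorem of_mem (n : ℕ) (h : s ⊆ W n) : IsBoundedFor W s :=
  ⟨n, 1, by rwa [pow_one]⟩

theorem singleton (hW : (⋃ n, W n) = univ) (g : G) : IsBoundedFor W {g} := by
  obtain ⟨n, hn⟩ := mem_iUnion.1 (hW ▸ mem_univ g)
  exact of_mem n (singleton_subset_iff.2 hn)

theorem mul (hW : Monotone W) (hs : IsBoundedFor W s) (ht : IsBoundedFor W t) :
    IsBoundedFor W (s * t) := by
  obtain ⟨n, k, hs⟩ := hs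
  obtain ⟨m, l, ht⟩ := ht
  refine ⟨max n m, k + l, ?_⟩
  rw [pow_add]
  exact Set.mul_subset_mul (hs.trans (Set.pow_subset_pow_left (hW (le_max_left _ _))))
    (ht.trans (Set.pow_subset_pow_left (hW (le_max_right _ _))))

theorem inv (hW : ∀ n, (W n)⁻¹ = W n) (hs : IsBoundedFor W s) : IsBoundedFor W s⁻¹ := by
  obtain ⟨n, k, hs⟩ := hs
  refine ⟨n, k, ?_⟩
  rw [← hW n, inv_pow]
  exact Set.inv_subset_inv.2 hs

end IsBoundedFor

namespace UnitaryV

open ratSpan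

variable {Q : Subfield ℂ} [IsAlgClosed Q]

/-- If a set `W` of isometries and a conjugate of it induce all isometries supported on their
respective pieces, then commutators of isometries supported on the intersection of the pieces
are commutators of elements of `W` and of its conjugate. -/
theorem commutator_eq_of_eq_on {A B : Set ℕ} (hAB : A ∪ B = univ) {a b y z : UnitaryV Q}
    (ha : a ∈ supportSubgroup Q (A ∩ B)) (hb : b ∈ supportSubgroup Q (A ∩ B))
    (hy : ∀ j ∈ A, y (basis Q j) = a (basis Q j)) (hz : ∀ j ∈ B, z (basis Q j) = b (basis Q j)) :
    a * b * a⁻¹ * b⁻¹ = y * z * y⁻¹ * z⁻¹ := by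
  -- The error factors `y'` and `z'` live on the complements of `A` and `B`, which are disjoint from
  -- each other and from `A ∩ B`. They therefore commute with `a`, with `b` and with one another,
  -- and cancel from the commutator.
  obtain ⟨y', rfl⟩ : ∃ y', y = a * y' := ⟨a⁻¹ * y, by group⟩
  obtain ⟨z', rfl⟩ : ∃ z', z = b * z' := ⟨b⁻¹ * z, by group⟩
  have hcancel : ∀ (g h : UnitaryV Q) (x : ratSpan Q), (g * h) x = g x → h x = x := fun g h x hx =>
    by rw [← inv_apply_self g (h x), ← mul_apply g, hx, inv_apply_self]
  have hy' : y' ∈ supportSubgroup Q Aᶜ := fun j hj => hcancel a y' _ (hy j (not_not.1 hj))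
  have hz' : z' ∈ supportSubgroup Q Bᶜ := fun j hj => hcancel b z' _ (hz j (not_not.1 hj))
  have hA : Disjoint Aᶜ (A ∩ B) := disjoint_compl_left.mono_right inter_subset_left
  have hB : Disjoint Bᶜ (A ∩ B) := disjoint_compl_left.mono_right inter_subset_right
  have hABc : Disjoint Aᶜ Bᶜ := by
    rw [Set.disjoint_iff_inter_eq_empty, ← compl_union, hAB, compl_univ]
  have e1 := commute_of_mem hA hy' ha
  have e2 := commute_of_mem hA hy' hb
  have e3 := commute_of_mem hB hz' ha
  have e4 := commute_of_mem hB hz' hb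
  have e5 := commute_of_mem hABc hy' hz'
  have h1 : Commute y' (b * z') := e2.mul_right e5
  have h2 : Commute z' a⁻¹ := e3.inv_right
  calc a * b * a⁻¹ * b⁻¹ = a * b * (a⁻¹ * z') * z'⁻¹ * b⁻¹ := by group
    _ = a * (b * z' * y') * y'⁻¹ * a⁻¹ * (b * z')⁻¹ := by rw [← h2.eq]; group
    _ = a * y' * (b * z') * (a * y')⁻¹ * (b * z')⁻¹ := by rw [← h1.eq]; group

/-- An isometry supported on one of infinitely many pieces permuted by a shift is a commutator. -/
theorem exists_eq_commutator {Δ : ℤ → Set ℕ} (hΔ : Pairwise (Function.onFun Disjoint Δ))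
    {s : Equiv.Perm ℕ} (hs : ∀ z j, s j ∈ Δ (z + 1) ↔ j ∈ Δ z) {T : UnitaryV Q}
    (hT : T ∈ supportSubgroup Q (Δ 0)) :
    ∃ a ∈ supportSubgroup Q (⋃ z, Δ z), T = a * permHom Q s * a⁻¹ * (permHom Q s)⁻¹ := by
  have himage : ∀ i : ℕ, (s ^ i) '' Δ 0 ⊆ Δ i := by
    intro i
    rintro _ ⟨j, hj, rfl⟩
    induction i with
    | zero => simpa using hj
    | succ i ih =>
      rw [pow_succ', Equiv.Perm.mul_apply]
      exact_mod_cast (hs _ _).2 ih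
  -- A swindle: `a` is the direct sum of the translates of `T` on the pieces `Δ i`, `i ≥ 0`.
  -- Conjugation by the shift moves it to the pieces with `i ≥ 1`, so the missing factor is `T`
  -- itself.
  obtain ⟨a, ha, haT⟩ := exists_glue (A := fun i : ℕ => Δ i)
    (T := fun i => permHom Q (s ^ i) * T * (permHom Q (s ^ i))⁻¹)
    (fun i j hij => hΔ (by exact_mod_cast hij))
    (fun i => supportSubgroup_mono (himage i) (permHom_conj_mem hT (s ^ i)))
  refine ⟨a, supportSubgroup_mono (iUnion_subset fun i : ℕ => subset_iUnion Δ i) ha, ?_⟩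
  have key : T * (permHom Q s * a * (permHom Q s)⁻¹) = a := by
    refine ext_basis fun j => ?_
    obtain ⟨k, rfl⟩ := s.surjective j
    simp only [mul_apply, ← map_inv, permHom_basis]
    rw [show s⁻¹ (s k) = k from s.symm_apply_apply k]
    by_cases hk : ∃ i : ℕ, k ∈ Δ i
    · obtain ⟨i, hi⟩ := hk
      have hsk : s k ∈ Δ ((i + 1 : ℕ) : ℤ) := by exact_mod_cast (hs _ _).2 hi
      have hconj : a (basis Q (s k)) = permHom Q s (a (basis Q k)) := by
        rw [haT _ _ hsk, haT _ _ hi, pow_succ', map_mul]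
        simp only [mul_inv_rev, mul_apply]
        rw [← permHom_basis, inv_apply_self]
      rw [← hconj]
      refine apply_eq_self_of_mem hT (hΔ ?_) (haT _ _ hsk ▸ supportedIn_of_mem
        (supportSubgroup_mono (himage (i + 1)) (permHom_conj_mem hT (s ^ (i + 1)))) subset_rfl
        (.basis hsk))
      have : (0 : ℤ) ≤ i := by positivity
      push_cast
      omega
    · rw [ha k (by simpa using hk), permHom_basis]
      by_cases h0 : s k ∈ Δ 0
      · have := haT 0 (s k) (by exact_mod_cast h0)
        simpa using this.symm
      · rw [hT _ h0, ha]
        intro h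
        obtain ⟨i, hi⟩ := mem_iUnion.1 h
        rcases i with _ | i
        · exact h0 (by exact_mod_cast hi)
        · exact hk ⟨i, (hs _ _).1 (by exact_mod_cast hi)⟩
  exact (eq_mul_inv_of_mul_eq key).trans (by group)

variable {W : ℕ → Set (UnitaryV Q)}

/-- Some member of an exhaustive sequence induces all isometries supported on a suitable piece. -/
theorem exists_full (hW : (⋃ n, W n) = univ) {A : ℕ → Set ℕ}
    (hA : Pairwise (Function.onFun Disjoint A)) :
    ∃ n, ∀ T ∈ supportSubgroup Q (A n), ∃ S ∈ W n, ∀ j ∈ A n, S (basis Q j) = T (basis Q j) := by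
  -- Diagonal argument: counterexamples for all `n` glue to one isometry `S`, which would have to
  -- avoid every `W n`.
  by_contra! h
  choose T hT hTW using h
  obtain ⟨S, -, hS⟩ := exists_glue hA hT
  obtain ⟨n, hn⟩ := mem_iUnion.1 (hW ▸ mem_univ S)
  obtain ⟨j, hj, hne⟩ := hTW n S hn
  exact hne (hS n j hj)

/-- For a symmetric increasing exhaustive sequence, the isometries supported on some infinite
coinfinite set are bounded. -/
theorem exists_isBoundedFor (hWm : Monotone W) (hW : (⋃ n, W n) = univ)
    (hWi : ∀ n, (W n)⁻¹ = W n) :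
    ∃ D : Set ℕ, D.Infinite ∧ Dᶜ.Infinite ∧
      IsBoundedFor W (supportSubgroup Q D : Set (UnitaryV Q)) := by
  obtain ⟨r, hr⟩ := (infinite_univ (α := ℕ)).exists_label ℕ
  obtain ⟨n, hn⟩ := exists_full hW (A := fun n => r ⁻¹' {n})
    fun m n hmn => Disjoint.preimage _ (Set.disjoint_singleton.2 hmn)
  have hinf : (r ⁻¹' {n}).Infinite := by simpa [preimage] using hr n
  have hinf' : (r ⁻¹' {n})ᶜ.Infinite := (hr (n + 1)).mono fun j hj => by
    simp only [mem_univ, true_and, mem_ofPred_eq] at hj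
    simp [hj]
  obtain ⟨A, hA⟩ : ∃ A, A = r ⁻¹' {n} := ⟨_, rfl⟩
  rw [← hA] at hn hinf hinf'
  obtain ⟨l, hl⟩ := hinf.exists_label (Option ℤ)
  classical
  -- Here `none` is the complement of `A`, `some none` a reserve inside `A`, and `some (some z)` the
  -- piece `Δ z`. The permutation `τ` exchanges the complement with the reserve, so `A` and `B = τ
  -- '' A` cover `ℕ` and both contain all `Δ z`; `s` shifts these pieces.
  obtain ⟨p, hpA, hpA'⟩ : ∃ p : ℕ → Option (Option ℤ),
      (∀ j ∈ A, p j = some (l j)) ∧ ∀ j, j ∉ A → p j = none :=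
    ⟨fun j => if j ∈ A then some (l j) else none, fun j hj => if_pos hj, fun j hj => if_neg hj⟩
  have hp : ∀ i, (p ⁻¹' {i}).Infinite := by
    rintro (_ | i)
    · exact hinf'.mono fun j hj => hpA' j hj
    · exact (hl i).mono fun j hj => by
        rw [mem_preimage, hpA j hj.1, hj.2]
        rfl
  have hpnone : ∀ j, p j = none ↔ j ∉ A := fun j =>
    ⟨fun h hj => by rw [hpA j hj] at h; exact absurd h (by simp), hpA' j⟩
  obtain ⟨τ, hτ, -⟩ := exists_perm_lift hp (Equiv.swap none (some none))
  obtain ⟨s, hs, hs'⟩ := exists_perm_lift hp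
    (Equiv.optionCongr (Equiv.optionCongr (Equiv.addRight (1 : ℤ))))
  obtain ⟨Δ, hΔ⟩ : ∃ Δ : ℤ → Set ℕ, ∀ z j, j ∈ Δ z ↔ p j = some (some z) :=
    ⟨fun z => p ⁻¹' {some (some z)}, fun _ _ => Iff.rfl⟩
  obtain ⟨B, hB⟩ : ∃ B, B = τ '' A := ⟨_, rfl⟩
  have hmemB : ∀ j, p j ≠ some none → j ∈ B := by
    intro j hj
    obtain ⟨x, rfl⟩ := τ.surjective j
    rw [hB]
    refine mem_image_of_mem τ (by_contra fun hx => hj ?_)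
    rw [hτ, hpA' x hx, Equiv.swap_apply_left]
  have hAB : A ∪ B = univ := eq_univ_of_forall fun j => or_iff_not_imp_left.2 fun hj =>
    hmemB j (by rw [hpA' j hj]; simp)
  have hΔAB : ⋃ z, Δ z ⊆ A ∩ B := iUnion_subset fun z j hj => by
    rw [hΔ] at hj
    exact ⟨by_contra fun h => by simp [hpA' j h] at hj, hmemB j (by simp [hj])⟩
  have hΔdisj : Pairwise (Function.onFun Disjoint Δ) := fun y z hyz =>
    Set.disjoint_left.2 fun j hy hz => hyz (by
      rw [hΔ] at hy hz
      simpa using hy.symm.trans hz)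
  have hsΔ : ∀ z j, s j ∈ Δ (z + 1) ↔ j ∈ Δ z := by
    intro z j
    rw [hΔ, hΔ, hs]
    rcases p j with _ | _ | y <;> simp
  have hsmem : permHom Q s ∈ supportSubgroup Q (⋃ z, Δ z) := permHom_mem fun j hj => hs' j (by
    rcases hpj : p j with _ | _ | y
    · simp
    · simp
    · exact absurd (mem_iUnion.2 ⟨y, (hΔ y j).2 hpj⟩) hj)
  refine ⟨Δ 0, (hp (some (some 0))).mono fun j hj => (hΔ 0 j).2 hj,
    hinf'.mono fun j (hj : j ∉ A) hj' =>
    hj (hΔAB (mem_iUnion.2 ⟨0, hj'⟩)).1, ?_⟩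
  have hWn : IsBoundedFor W (W n) := .of_mem n subset_rfl
  have hWn' : IsBoundedFor W ({permHom Q τ} * W n * {(permHom Q τ)⁻¹}) :=
    ((IsBoundedFor.singleton hW _).mul hWm hWn).mul hWm (.singleton hW _)
  refine (((hWn.mul hWm hWn').mul hWm (hWn.inv hWi)).mul hWm (hWn'.inv hWi)).subset ?_
  intro T hT
  -- In this commutator, `a` can be replaced by an element of `W n` agreeing with it on `A`, and the
  -- shift by a `τ`-conjugate of an element of `W n` agreeing with it on `B`.
  obtain ⟨a, ha, rfl⟩ := exists_eq_commutator hΔdisj hsΔ hT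
  have ha' := supportSubgroup_mono hΔAB ha
  have hb' := supportSubgroup_mono hΔAB hsmem
  obtain ⟨y, hyW, hy⟩ := hn a (supportSubgroup_mono inter_subset_left ha')
  obtain ⟨y', hyW', hy'⟩ := hn (permHom Q τ⁻¹ * permHom Q s * (permHom Q τ⁻¹)⁻¹) (by
    have := permHom_conj_mem (supportSubgroup_mono inter_subset_right hb') τ⁻¹
    rw [hB, ← image_comp] at this
    refine supportSubgroup_mono ?_ this
    rintro _ ⟨j, hj, rfl⟩
    rwa [Function.comp_apply, show τ⁻¹ (τ j) = j from τ.symm_apply_apply j])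
  rw [commutator_eq_of_eq_on hAB ha' hb' hy
    (z := permHom Q τ * y' * (permHom Q τ)⁻¹) fun j hj => ?_]
  · exact Set.mul_mem_mul (Set.mul_mem_mul (Set.mul_mem_mul hyW
      (Set.mul_mem_mul (Set.mul_mem_mul rfl hyW') rfl)) (Set.inv_mem_inv.2 hyW))
      (Set.inv_mem_inv.2 (Set.mul_mem_mul (Set.mul_mem_mul rfl hyW') rfl))
  · rw [hB] at hj
    obtain ⟨x, hx, rfl⟩ := hj
    simp only [mul_apply, map_inv] at hy' ⊢
    rw [← permHom_basis, inv_apply_self, hy' x hx]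
    simp

/-- Any two infinite coinfinite sets are exchanged by a permutation. The bound obtained depends on
`D` through that permutation, a dependence that the next lemma removes. -/
theorem isBoundedFor_supportSubgroup_of_infinite (hWm : Monotone W) (hW : (⋃ n, W n) = univ)
    (hWi : ∀ n, (W n)⁻¹ = W n) {D : Set ℕ} (hD : D.Infinite) (hD' : Dᶜ.Infinite) :
    IsBoundedFor W (supportSubgroup Q D : Set (UnitaryV Q)) := by
  obtain ⟨E, hE, hE', hbdd⟩ := exists_isBoundedFor hWm hW hWi
  obtain ⟨σ, hσ, -⟩ := exists_perm_of_infinite_fibers (p := (· ∈ D)) (q := (· ∈ E)) ∅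
    (fun P _ => by
      by_cases hP : P
      · exact hD.mono fun j hj => by simp [hP, hj]
      · exact hD'.mono fun j hj => by simpa [hP] using hj)
    (fun P _ => by
      by_cases hP : P
      · exact hE.mono fun j hj => by simp [hP, hj]
      · exact hE'.mono fun j hj => by simpa [hP] using hj)
    (by simp)
  refine (((IsBoundedFor.singleton hW (permHom Q σ)⁻¹).mul hWm hbdd).mul hWm
    (.singleton hW (permHom Q σ))).subset fun T hT => ?_
  refine ⟨(permHom Q σ)⁻¹ * (permHom Q σ * T * (permHom Q σ)⁻¹), Set.mul_mem_mul rfl ?_,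
    permHom Q σ, rfl, by group⟩
  refine supportSubgroup_mono ?_ (permHom_conj_mem hT σ)
  rintro _ ⟨j, hj, rfl⟩
  exact (hσ j).symm ▸ hj

/-- There is an infinite set `A` such that the isometries fixing infinitely many `e_j`, `j ∈ A`,
are uniformly bounded. -/
theorem exists_isBoundedFor_uniform (hWm : Monotone W) (hW : (⋃ n, W n) = univ)
    (hWi : ∀ n, (W n)⁻¹ = W n) :
    ∃ (A : Set ℕ) (s : Set (UnitaryV Q)), A.Infinite ∧ IsBoundedFor W s ∧
      ∀ D : Set ℕ, (A \ D).Infinite → (supportSubgroup Q D : Set (UnitaryV Q)) ⊆ s := by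
  obtain ⟨r, hr⟩ := (infinite_univ (α := ℕ)).exists_label (Fin 3)
  have hr : ∀ i, (r ⁻¹' {i}).Infinite := fun i => by simpa [preimage] using hr i
  have h1 := isBoundedFor_supportSubgroup_of_infinite hWm hW hWi (D := {j | r j ≠ 2})
    ((hr 0).mono fun j hj => by simp_all) ((hr 2).mono fun j hj => by simp_all)
  have h2 := isBoundedFor_supportSubgroup_of_infinite hWm hW hWi (D := {j | r j ≠ 1})
    ((hr 0).mono fun j hj => by simp_all) ((hr 1).mono fun j hj => by simp_all)
  refine ⟨r ⁻¹' {0}, _, hr 0, ((h1.inv hWi).mul hWm h2).mul hWm h1, fun D hD T hT => ?_⟩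
  classical
  -- The permutation `σ` sends `A \ D` onto the fiber of `1` and fixes the fiber of `2`. So `σ` and
  -- the conjugate of `T` by it avoid the fibers of `2` and `1` respectively, and these subgroups do
  -- not depend on `D`.
  obtain ⟨p, hp⟩ : ∃ p : ℕ → Fin 3, ∀ j, p j =
      if r j = 2 then 2 else if j ∈ r ⁻¹' {0} \ D then 1 else 0 := ⟨_, fun _ => rfl⟩
  obtain ⟨σ, hσ, hσ'⟩ := exists_perm_of_infinite_fibers (p := p) (q := r) {2}
    (fun i hi => by
      fin_cases i
      · refine (hr 1).mono fun j hj => ?_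
        simp_all
      · refine hD.mono fun j hj => ?_
        simp_all
      · simp at hi)
    (fun i _ => hr i)
    (fun x hx => by
      rw [hp] at hx ⊢
      split_ifs at hx ⊢ <;> simp_all)
  have hmem : permHom Q σ ∈ supportSubgroup Q {j | r j ≠ 2} := permHom_mem fun j hj => hσ' j (by
    simp only [ne_eq, mem_ofPred_eq, not_not] at hj
    simp [hp, hj])
  refine ⟨(permHom Q σ)⁻¹ * (permHom Q σ * T * (permHom Q σ)⁻¹),
    Set.mul_mem_mul (Set.inv_mem_inv.2 hmem) ?_, permHom Q σ, hmem, by group⟩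
  refine supportSubgroup_mono ?_ (permHom_conj_mem hT σ)
  rintro _ ⟨j, hj, rfl⟩
  change r (σ j) ≠ 1
  rw [hσ, hp]
  split_ifs with h h' <;> simp_all

/-- Every isometry is a product of two isometries, each of which fixes infinitely many `e_j` with
`j ∈ A`. -/
theorem exists_eq_mul_of_infinite (hQ : ∀ z ∈ Q, conj z ∈ Q) {A : Set ℕ} (hA : A.Infinite)
    (T : UnitaryV Q) :
    ∃ D E : Set ℕ, (A \ D).Infinite ∧ (A \ E).Infinite ∧
      ∃ R ∈ supportSubgroup Q D, ∃ S ∈ supportSubgroup Q E, T = R * S := by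
  -- Taking `a` beyond the supports of `T⁻¹ e_i` for `i < M` makes `T e_a` vanish below `M`; then
  -- `c` is taken beyond `a` and the support of `T e_a`.
  have hstep : ∀ M : ℕ, ∃ a c : ℕ, M ≤ a ∧ a < c ∧ a ∈ A ∧ c ∈ A ∧
      SupportedIn (Ico M c) (T (basis Q a)) := by
    intro M
    obtain ⟨K, hK⟩ := exists_supportedIn_Iio_of_finite fun i : Fin M => T⁻¹ (basis Q i)
    obtain ⟨a, haA, ha⟩ := hA.exists_gt (max K M)
    obtain ⟨L, hL⟩ := exists_supportedIn_Iio (T (basis Q a))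
    obtain ⟨c, hcA, hc⟩ := hA.exists_gt (max L a)
    rw [max_lt_iff] at ha hc
    refine ⟨a, c, ha.2.le, hc.2, haA, hcA, fun j hj => ?_⟩
    by_cases hjM : j < M
    · rw [coe_apply_apply]
      exact (hK K le_rfl ⟨j, hjM⟩).inner_eq_zero
        (Set.disjoint_left.2 fun i hi hi' => by simp only [mem_Iio, mem_Ici] at hi hi'; omega)
        (.basis (A := Ici (K + 1)) (by simp only [mem_Ici]; omega))
    · refine hL c hc.1.le j fun h => hj ⟨not_lt.1 hjM, h⟩
  choose a c hMa hac haA hcA hsupp using hstep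
  -- The `+ 1` leaves the index `c (M i)` outside all blocks, so `R` fixes these basis vectors.
  -- Inside the blocks `R` copies `T` at the indices `a (M i)`, so `R⁻¹ * T` fixes those.
  obtain ⟨M, hM⟩ : ∃ M : ℕ → ℕ, ∀ i, M (i + 1) = c (M i) + 1 :=
    ⟨fun i => Nat.rec 0 (fun _ m => c m + 1) i, fun _ => rfl⟩
  have hMc : ∀ i, M i < c (M i) := fun i => (hMa _).trans_lt (hac _)
  have hMmono : StrictMono M := strictMono_nat_of_lt_succ fun i => by
    rw [hM]
    have := hMc i
    omega
  have hdisj : Pairwise (Function.onFun Disjoint fun i => Ico (M i) (M (i + 1))) :=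
    hMmono.monotone.pairwise_disjoint_on_Ico_succ
  have hsub : ∀ i, Ico (M i) (c (M i)) ⊆ Ico (M i) (M (i + 1)) := fun i =>
    Ico_subset_Ico_right (by rw [hM]; omega)
  have hU : ∀ i, ∃ U ∈ supportSubgroup Q (Ico (M i) (c (M i))),
      U (basis Q (a (M i))) = T (basis Q (a (M i))) := by
    intro i
    obtain ⟨U, hU, hUx⟩ := exists_map_eq_of_inner_eq hQ (n := 1)
      (x := fun _ => basis Q (a (M i))) (y := fun _ => T (basis Q (a (M i))))
      (fun _ _ => .basis (mem_Ico.2 ⟨hMa _, hac _⟩)) (fun _ _ => hsupp (M i))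
      (fun _ _ _ _ => by rw [inner_map_map])
    exact ⟨U, hU, hUx 0 one_pos⟩
  choose U hUmem hUa using hU
  obtain ⟨R, hR, hRU⟩ := exists_glue (A := fun i => Ico (M i) (c (M i)))
    (fun i j hij => (hdisj hij).mono (hsub i) (hsub j)) hUmem
  have hinj : ∀ f : ℕ → ℕ, (∀ i, f i ∈ Ico (M i) (M (i + 1))) → f.Injective := by
    intro f hf i j hij
    by_contra hne
    exact Set.disjoint_left.1 (hdisj hne) (hf i) (hij ▸ hf j)
  have hc : ∀ i, c (M i) ∈ Ico (M i) (M (i + 1)) := fun i =>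
    ⟨(hMc i).le, by rw [hM]; exact Nat.lt_succ_self _⟩
  have ha : ∀ i, a (M i) ∈ Ico (M i) (c (M i)) := fun i => ⟨hMa _, hac _⟩
  refine ⟨⋃ i, Ico (M i) (c (M i)), (range fun i => a (M i))ᶜ,
    (infinite_range_of_injective (hinj _ hc)).mono ?_,
    (infinite_range_of_injective (hinj _ fun i => hsub i (ha i))).mono ?_,
    R, hR, R⁻¹ * T, fun j hj => ?_, by group⟩
  · rintro _ ⟨i, rfl⟩
    refine ⟨hcA _, fun h => ?_⟩
    obtain ⟨k, hk⟩ := mem_iUnion.1 h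
    by_cases hik : i = k
    · subst hik
      exact lt_irrefl _ hk.2
    · exact Set.disjoint_left.1 (hdisj hik) (hc i) (hsub k hk)
  · rintro _ ⟨i, rfl⟩
    exact ⟨haA _, fun h => h ⟨i, rfl⟩⟩
  · obtain ⟨i, rfl⟩ := not_not.1 hj
    rw [mul_apply, inv_apply_eq_iff, hRU i _ (ha i), hUa]

theorem hasBergmanProperty (hQ : ∀ z ∈ Q, conj z ∈ Q) : HasBergmanProperty (UnitaryV Q) := by
  intro W hWm hW
  -- Passing to symmetric sets; monotonicity keeps them exhaustive.
  obtain ⟨W', hW'⟩ : ∃ W' : ℕ → Set (UnitaryV Q), ∀ n, W' n = W n ∩ (W n)⁻¹ := ⟨_, fun _ => rfl⟩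
  have hWm' : Monotone W' := fun m n hmn => by
    rw [hW', hW']
    exact inter_subset_inter (hWm hmn) (Set.inv_subset_inv.2 (hWm hmn))
  have hWu' : (⋃ n, W' n) = univ := by
    refine eq_univ_of_forall fun g => ?_
    obtain ⟨m, hm⟩ := mem_iUnion.1 (hW ▸ mem_univ g)
    obtain ⟨n, hn⟩ := mem_iUnion.1 (hW ▸ mem_univ g⁻¹)
    refine mem_iUnion.2 ⟨max m n, ?_⟩
    rw [hW']
    exact ⟨hWm (le_max_left _ _) hm, hWm (le_max_right _ _) hn⟩
  have hWi' : ∀ n, (W' n)⁻¹ = W' n := fun n => by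
    rw [hW', Set.inter_inv, inv_inv, inter_comm]
  obtain ⟨A, s, hA, hs, hsD⟩ := exists_isBoundedFor_uniform hWm' hWu' hWi'
  obtain ⟨n, k, hnk⟩ := hs.mul hWm' hs
  refine ⟨n, k, eq_univ_of_forall fun T => ?_⟩
  obtain ⟨D, E, hD, hE, R, hR, S, hS, rfl⟩ := exists_eq_mul_of_infinite hQ hA T
  have := hnk (Set.mul_mem_mul (hsD D hD hR) (hsD E hE hS))
  rw [hW'] at this
  exact Set.pow_subset_pow_left inter_subset_left this

end UnitaryV

/-! ### Cyclically dense conjugacy classes -/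

/-- A permutation of `ℕ` whose powers displace every finite set. -/
theorem exists_displacing_perm :
    ∃ σ : Equiv.Perm ℕ, ∀ L : ℕ, ∃ n : ℕ, ∀ j < L, L ≤ (σ ^ n) j := by
  let e : ℕ ≃ ℤ := Equiv.intEquivNat.symm
  refine ⟨e.trans ((Equiv.addRight 1).trans e.symm), fun L => ?_⟩
  have hpow : ∀ (n j : ℕ), e (((e.trans ((Equiv.addRight 1).trans e.symm) : Equiv.Perm ℕ) ^ n) j) =
      e j + n := by
    intro n
    induction n with
    | zero => simp
    | succ n ih =>
      intro j
      rw [pow_succ', Equiv.Perm.mul_apply]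
      simp only [Equiv.trans_apply, Equiv.coe_addRight, Equiv.apply_symm_apply, ih]
      push_cast
      ring
  obtain ⟨B, hB⟩ := ((Set.finite_Iio L).image fun j => (e j).natAbs).bddAbove
  have hB' : ∀ j < L, (e j).natAbs ≤ B := fun j hj => hB ⟨j, hj, rfl⟩
  -- Transported to `ℤ`, the indices below `L` lie in `[-B, B]`, and translation by `2 * B + 1`
  -- takes this interval off itself.
  refine ⟨2 * B + 1, fun j hj => ?_⟩
  by_contra! h
  have h1 := hB' _ h
  have h2 := hB' j hj
  rw [hpow] at h1
  omega

namespace UnitaryV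

open ratSpan

variable {Q : Subfield ℂ}

theorem exists_finite_of_mem_nhds_pi {ι : Type*} {h : ι → UnitaryV Q} {U : Set (ι → UnitaryV Q)}
    (hU : U ∈ 𝓝 h) : ∃ (I : Set ι) (K : ℕ), I.Finite ∧ ∀ h' : ι → UnitaryV Q,
      (∀ i ∈ I, ∀ j < K, h' i (basis Q j) = h i (basis Q j)) → h' ∈ U := by
  rw [nhds_pi, Filter.mem_pi] at hU
  obtain ⟨I, hI, t, ht, htU⟩ := hU
  choose K _ hK using fun i => (nhds_hasBasis (h i)).mem_iff.1 (ht i)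
  obtain ⟨B, hB⟩ := (hI.image K).bddAbove
  exact ⟨I, B, hI, fun h' hh => htU fun i hi =>
    hK i fun j hj => hh i hi j (hj.trans_le (hB ⟨i, hi, rfl⟩))⟩

variable [IsAlgClosed Q]

theorem exists_finite_support_pi (hQ : ∀ z ∈ Q, conj z ∈ Q) {ι : Type*} (h : ι → UnitaryV Q)
    {I : Set ι} (hI : I.Finite) (L : ℕ) :
    ∃ K, ∀ M, K ≤ M → ∃ u : ι → UnitaryV Q, ∀ i ∈ I, u i ∈ supportSubgroup Q (Iio M) ∧
      ∀ j < L, u i (basis Q j) = h i (basis Q j) := by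
  choose K hK using fun i => exists_finite_support hQ (h i) L
  obtain ⟨B, hB⟩ := (hI.image K).bddAbove
  refine ⟨B, fun M hM => ?_⟩
  have : ∀ i, ∃ u : UnitaryV Q, i ∈ I → u ∈ supportSubgroup Q (Iio M) ∧
      ∀ j < L, u (basis Q j) = h i (basis Q j) := fun i => by
    by_cases hi : i ∈ I
    · obtain ⟨u, hu, huj⟩ := hK i M ((hB ⟨i, hi, rfl⟩).trans hM)
      exact ⟨u, fun _ => ⟨hu, huj⟩⟩
    · exact ⟨1, fun h => absurd h hi⟩
  choose u hu using this
  exact ⟨u, hu⟩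

/-- Topological transitivity of conjugation by `permHom Q σ`. -/
theorem exists_conj_mem_of_isOpen (hQ : ∀ z ∈ Q, conj z ∈ Q) {σ : Equiv.Perm ℕ}
    (hσ : ∀ L : ℕ, ∃ n : ℕ, ∀ j < L, L ≤ (σ ^ n) j) {U O : Set (ℕ → UnitaryV Q)}
    (hU : IsOpen U) (hUne : U.Nonempty) (hO : IsOpen O) (hOne : O.Nonempty) :
    ∃ h ∈ U, ∃ n : ℤ, (fun k => permHom Q σ ^ n * h k * permHom Q σ ^ (-n)) ∈ O := by
  obtain ⟨p, hp⟩ := hUne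
  obtain ⟨q, hq⟩ := hOne
  obtain ⟨I, K, hI, hIK⟩ := exists_finite_of_mem_nhds_pi (hU.mem_nhds hp)
  obtain ⟨J, K', hJ, hJK⟩ := exists_finite_of_mem_nhds_pi (hO.mem_nhds hq)
  obtain ⟨M, hM⟩ := exists_finite_support_pi hQ p (hI.union hJ) K
  obtain ⟨M', hM'⟩ := exists_finite_support_pi hQ q (hI.union hJ) K'
  obtain ⟨L, hML, hML', hKL, hKL'⟩ : ∃ L, M ≤ L ∧ M' ≤ L ∧ K ≤ L ∧ K' ≤ L :=
    ⟨M + M' + K + K', by omega, by omega, by omega, by omega⟩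
  obtain ⟨u, hu⟩ := hM L hML
  obtain ⟨v, hv⟩ := hM' L hML'
  obtain ⟨n, hn⟩ := hσ L
  obtain ⟨τ, hτ⟩ : ∃ τ, τ = σ ^ n := ⟨_, rfl⟩
  have hτσ : permHom Q τ = permHom Q σ ^ (n : ℤ) := by rw [hτ, map_pow, zpow_natCast]
  rw [← hτ] at hn
  have hdisj : Disjoint (τ '' Iio L) (Iio L) := Set.disjoint_left.2 fun i hi hi' => by
    obtain ⟨j, hj, rfl⟩ := hi
    exact absurd hi' (not_lt.2 (hn j hj))
  have hdisj' : Disjoint (⇑τ⁻¹ '' Iio L) (Iio L) := Set.disjoint_left.2 fun i hi hi' => by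
    obtain ⟨j, hj, rfl⟩ := hi
    have := hn _ hi'
    rw [show τ (τ⁻¹ j) = j from τ.apply_symm_apply j] at this
    exact absurd hj (not_lt.2 this)
  -- On the initial span the second factor is trivial, leaving `u`. Conjugation by `τ` displaces `u`
  -- and brings `v` back, so there only `v` is seen.
  refine ⟨fun k => u k * (permHom Q τ⁻¹ * v k * (permHom Q τ⁻¹)⁻¹), hIK _ fun i hi j hj => ?_, n,
    hJK _ fun i hi j hj => ?_⟩
  · rw [mul_apply, apply_eq_self_of_mem (permHom_conj_mem (hv i (Or.inl hi)).1 τ⁻¹) hdisj'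
      (.basis (mem_Iio.2 (hj.trans_le hKL))), (hu i (Or.inl hi)).2 j hj]
  · rw [zpow_neg, ← hτσ, map_inv, ← (hv i (Or.inr hi)).2 j hj]
    have : permHom Q τ * (u i * ((permHom Q τ)⁻¹ * v i * (permHom Q τ)⁻¹⁻¹)) * (permHom Q τ)⁻¹ =
        (permHom Q τ * u i * (permHom Q τ)⁻¹) * v i := by group
    rw [this, mul_apply, apply_eq_self_of_mem (permHom_conj_mem (hu i (Or.inr hi)).1 τ) hdisj
      (supportedIn_of_mem (hv i (Or.inr hi)).1 subset_rfl
        (.basis (mem_Iio.2 (hj.trans_le hKL'))))]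

/-- By transitivity, the sequences whose orbit meets a given basic open set form a dense open set;
Baire's theorem provides one that works for all of them. -/
theorem hasAmpleCyclicallyDenseConjClass [Countable Q] (hQ : ∀ z ∈ Q, conj z ∈ Q) :
    HasAmpleCyclicallyDenseConjClass (UnitaryV Q) := by
  obtain ⟨σ, hσ⟩ := exists_displacing_perm
  obtain ⟨F, hF⟩ : ∃ F : ℤ → (ℕ → UnitaryV Q) → ℕ → UnitaryV Q,
      ∀ n h, F n h = fun k => permHom Q σ ^ n * h k * permHom Q σ ^ (-n) := ⟨_, fun _ _ => rfl⟩
  have hFc : ∀ n, Continuous (F n) := fun n => by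
    rw [funext (hF n)]
    fun_prop
  have hdense : Dense (⋂ O ∈ TopologicalSpace.countableBasis (ℕ → UnitaryV Q),
      ⋃ n, F n ⁻¹' O) := by
    refine dense_biInter_of_isOpen (fun O hO => isOpen_iUnion fun n =>
      (TopologicalSpace.isOpen_of_mem_countableBasis hO).preimage (hFc n))
      (TopologicalSpace.countable_countableBasis _) fun O hO => dense_iff_inter_open.2
        fun U hU hUne => ?_
    obtain ⟨h, hhU, n, hn⟩ := exists_conj_mem_of_isOpen hQ hσ hU hUne
      (TopologicalSpace.isOpen_of_mem_countableBasis hO)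
      (TopologicalSpace.nonempty_of_mem_countableBasis hO)
    exact ⟨h, hhU, mem_iUnion.2 ⟨n, by rw [mem_preimage, hF]; exact hn⟩⟩
  obtain ⟨h, hh⟩ := hdense.nonempty
  refine ⟨isPolishGroup, permHom Q σ, h,
    (TopologicalSpace.isBasis_countableBasis _).dense_iff.2 fun O hO _ => ?_⟩
  obtain ⟨n, hn⟩ := mem_iUnion.1 (mem_iInter₂.1 hh O hO)
  exact ⟨F n h, hn, n, (hF n h).symm⟩

end UnitaryV

/-! ### Ample generics -/

namespace ratSpan

variable {Q : Subfield ℂ}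

theorem SupportedIn.sum {ι : Type*} {A : Set ℕ} {s : Finset ι} {x : ι → ratSpan Q}
    (h : ∀ i ∈ s, SupportedIn A (x i)) : SupportedIn A (∑ i ∈ s, x i) := by
  classical
  induction s using Finset.induction_on with
  | empty => exact fun _ _ => rfl
  | insert a s ha ih =>
    rw [Finset.sum_insert ha]
    exact (h a (Finset.mem_insert_self a s)).add
      (ih fun i hi => h i (Finset.mem_insert_of_mem hi))

/-- The projection to the span of the `e_j` with `j < K`. -/
noncomputable def truncate (K : ℕ) : ratSpan Q →ₗ[Q] ratSpan Q :=
  ∑ j ∈ Finset.range K, ((basis Q).coord j).smulRight (basis Q j)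

theorem truncate_apply (K : ℕ) (x : ratSpan Q) (i : ℕ) :
    (truncate K x : EllTwo) i = if i < K then (x : EllTwo) i else 0 := by
  rw [← EllTwo.inner_basis_left, truncate, LinearMap.sum_apply]
  simp only [LinearMap.smulRight_apply, Module.Basis.coord_apply, Submodule.coe_sum, coe_smul,
    inner_sum, inner_smul_right, coe_basis, orthonormal_iff_ite.1 EllTwo.orthonormal_basis,
    coe_repr]
  simp

theorem supportedIn_truncate (K : ℕ) (x : ratSpan Q) : SupportedIn (Iio K) (truncate K x) :=
  fun j hj => by rw [truncate_apply, if_neg (by simpa using hj)]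

theorem supportedIn_sub_truncate (K : ℕ) (x : ratSpan Q) :
    SupportedIn (Ici K) (x - truncate K x) := fun j hj => by
  have : (x : EllTwo) j - (truncate K x : EllTwo) j = 0 := by
    rw [truncate_apply, if_pos (not_le.1 hj), sub_self]
  simpa using this

theorem truncate_eq_self {K : ℕ} {x : ratSpan Q} (hx : SupportedIn (Iio K) x) :
    truncate K x = x := by
  refine Subtype.ext (lp.ext (funext fun j => ?_))
  rw [truncate_apply]
  split_ifs with h
  · rfl
  · exact (hx j h).symm

theorem truncate_eq_zero {K : ℕ} {x : ratSpan Q} (hx : SupportedIn (Ici K) x) :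
    truncate K x = 0 := by
  refine Subtype.ext (lp.ext (funext fun j => ?_))
  rw [truncate_apply]
  split_ifs with h
  · exact hx j (not_le.2 h)
  · rfl

theorem disjoint_Iio_Ici (K : ℕ) : Disjoint (Iio K) (Ici K) :=
  Set.disjoint_left.2 fun _ (h : _ < K) (h' : K ≤ _) => not_lt.2 h' h

theorem inner_truncate_add (K : ℕ) (x y : ratSpan Q) :
    ⟪(truncate K x : EllTwo), (truncate K y : EllTwo)⟫ +
      ⟪((x - truncate K x : ratSpan Q) : EllTwo), ((y - truncate K y : ratSpan Q) : EllTwo)⟫ =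
      ⟪(x : EllTwo), (y : EllTwo)⟫ := by
  have h1 := (supportedIn_truncate K x).inner_eq_zero (disjoint_Iio_Ici K)
    (supportedIn_sub_truncate K y)
  have h2 := (supportedIn_sub_truncate K x).inner_eq_zero (disjoint_Iio_Ici K).symm
    (supportedIn_truncate K y)
  simp only [Submodule.coe_sub, inner_sub_left, inner_sub_right] at h1 h2 ⊢
  linear_combination (-1 : ℂ) * h1 - h2

end ratSpan

namespace UnitaryV

open ratSpan

variable {Q : Subfield ℂ}

theorem supportedIn_of_basis {A B : Set ℕ} {T : UnitaryV Q}
    (hT : ∀ j ∈ A, SupportedIn B (T (basis Q j))) {x : ratSpan Q} (hx : SupportedIn A x) :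
    SupportedIn B (T x) := by
  obtain ⟨s, c, hs, rfl⟩ := hx.eq_sum
  simp only [map_sum, map_smul]
  exact SupportedIn.sum fun i hi => (hT i (hs i hi)).smul _

/-- The isometry `T` maps the span of the `e_j` with `j < K` onto itself. -/
def Preserves (K : ℕ) (T : UnitaryV Q) : Prop :=
  ∀ j < K, SupportedIn (Iio K) (T (basis Q j)) ∧ SupportedIn (Iio K) (T⁻¹ (basis Q j))

namespace Preserves

variable {K : ℕ} {T : UnitaryV Q}

theorem of_mem (hT : T ∈ supportSubgroup Q (Iio K)) [IsAlgClosed Q] : Preserves K T := fun _ hj =>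
  ⟨supportedIn_of_mem hT subset_rfl (.basis hj),
    supportedIn_of_mem (inv_mem hT) subset_rfl (.basis hj)⟩

theorem supportedIn_Iio (hT : Preserves K T) {x : ratSpan Q} (hx : SupportedIn (Iio K) x) :
    SupportedIn (Iio K) (T x) :=
  supportedIn_of_basis (fun j hj => (hT j hj).1) hx

/-- Since `T⁻¹` preserves the initial span, `T` preserves its orthogonal complement. -/
theorem supportedIn_Ici [IsAlgClosed Q] (hT : Preserves K T) {x : ratSpan Q}
    (hx : SupportedIn (Ici K) x) : SupportedIn (Ici K) (T x) := fun j hj => by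
  rw [coe_apply_apply]
  exact (hT j (not_le.1 hj)).2.inner_eq_zero (disjoint_Iio_Ici K) hx

theorem truncate_apply [IsAlgClosed Q] (hT : Preserves K T) (x : ratSpan Q) :
    truncate K (T x) = T (truncate K x) := by
  have hx : T x = T (truncate K x) + T (x - truncate K x) := by
    rw [← map_add, add_sub_cancel]
  rw [hx, map_add, truncate_eq_self (hT.supportedIn_Iio (supportedIn_truncate K x)),
    truncate_eq_zero (hT.supportedIn_Ici (supportedIn_sub_truncate K x)), add_zero]

end Preserves

/-- A tuple preserving arbitrarily large spans of initial segments of the basis, and containing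
a copy of every tuple of finite support away from every such span. -/
structure IsGenericTuple {m : ℕ} (h : Fin m → UnitaryV Q) : Prop where
  exists_preserves : ∀ N, ∃ K, N ≤ K ∧ ∀ i, Preserves K (h i)
  exists_copy : ∀ (N K : ℕ) (k : Fin m → UnitaryV Q), (∀ i, k i ∈ supportSubgroup Q (Iio K)) →
    ∃ g : UnitaryV Q, (∀ j < K, SupportedIn (Ici N) (g (basis Q j))) ∧
      ∀ i, ∀ j < K, h i (g (basis Q j)) = g (k i (basis Q j))

/-- An involution of `ℕ` moving an initial segment beyond a given bound. -/
theorem _root_.exists_perm_shift_initial {K M : ℕ} (hKM : K ≤ M) :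
    ∃ σ : Equiv.Perm ℕ, ∀ j < K, M ≤ σ j := by
  obtain ⟨σ, hσ⟩ : ∃ σ : ℕ → ℕ, ∀ j, σ j =
      if j < K then j + M else if M ≤ j ∧ j < M + K then j - M else j := ⟨_, fun _ => rfl⟩
  have hinv : Function.Involutive σ := fun j => by
    rw [hσ (σ j), hσ j]
    split_ifs <;> omega
  refine ⟨hinv.toPerm, fun j hj => ?_⟩
  rw [Function.Involutive.coe_toPerm, hσ, if_pos hj]
  omega

theorem isOpen_setOf_preserves {m : ℕ} (K : ℕ) :
    IsOpen {h : Fin m → UnitaryV Q | ∀ i, Preserves K (h i)} := by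
  have : {h : Fin m → UnitaryV Q | ∀ i, Preserves K (h i)} = ⋂ i, ⋂ j ∈ Iio K,
      ((fun h : Fin m → UnitaryV Q => h i) ⁻¹' {T | T (basis Q j) ∈ {x | SupportedIn (Iio K) x}} ∩
        (fun h : Fin m → UnitaryV Q => (h i)⁻¹) ⁻¹'
          {T | T (basis Q j) ∈ {x | SupportedIn (Iio K) x}}) := by
    ext h
    simp [Preserves]
  rw [this]
  refine isOpen_iInter_of_finite fun i => (Set.finite_Iio K).isOpen_biInter fun j _ => ?_
  exact ((isOpen_setOf_apply_mem _ _).preimage (by fun_prop)).inter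
    ((isOpen_setOf_apply_mem _ _).preimage (by fun_prop))

variable [IsAlgClosed Q]

theorem eventually_residual_isGenericTuple [Countable Q] (hQ : ∀ z ∈ Q, conj z ∈ Q) (m : ℕ) :
    ∀ᶠ h in residual (Fin m → UnitaryV Q), IsGenericTuple h := by
  have h1 : ∀ᶠ h in residual (Fin m → UnitaryV Q), ∀ N, ∃ K, N ≤ K ∧ ∀ i, Preserves K (h i) := by
    refine eventually_countable_forall.2 fun N => residual_of_dense_open ?_ fun h => ?_
    · have : {h : Fin m → UnitaryV Q | ∃ K, N ≤ K ∧ ∀ i, Preserves K (h i)} =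
          ⋃ K, ⋃ (_ : N ≤ K), {h : Fin m → UnitaryV Q | ∀ i, Preserves K (h i)} := by
        ext h
        simp
      rw [this]
      exact isOpen_iUnion fun K => isOpen_iUnion fun _ => isOpen_setOf_preserves K
    · refine mem_closure_iff_nhds.2 fun U hU => ?_
      obtain ⟨I, L, hI, hIL⟩ := exists_finite_of_mem_nhds_pi hU
      obtain ⟨K, hK⟩ := exists_finite_support_pi hQ h (Set.finite_univ) L
      obtain ⟨u, hu⟩ := hK (max K N) (le_max_left _ _)
      exact ⟨u, hIL u fun i _ => (hu i trivial).2, max K N, le_max_right _ _,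
        fun i => .of_mem (hu i trivial).1⟩
  -- Only the first `K` columns `c` of the tuple `k` matter. Quantifying over them instead of over
  -- `k` leaves countably many conditions.
  have h2 : ∀ᶠ h in residual (Fin m → UnitaryV Q), ∀ (N K : ℕ) (c : Fin m → Fin K → ratSpan Q),
      (∃ k : Fin m → UnitaryV Q, ∀ i, k i ∈ supportSubgroup Q (Iio K) ∧
        ∀ j : Fin K, k i (basis Q j) = c i j) →
      ∃ g : UnitaryV Q, (∀ j : Fin K, SupportedIn (Ici N) (g (basis Q j))) ∧
        ∀ i, ∀ j : Fin K, h i (g (basis Q j)) = g (c i j) := by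
    refine eventually_countable_forall.2 fun N => eventually_countable_forall.2 fun K =>
      eventually_countable_forall.2 fun c => ?_
    by_cases hc : ∃ k : Fin m → UnitaryV Q, ∀ i, k i ∈ supportSubgroup Q (Iio K) ∧
        ∀ j : Fin K, k i (basis Q j) = c i j
    swap
    · exact Eventually.of_forall fun h hc' => absurd hc' hc
    obtain ⟨k, hk⟩ := hc
    refine Eventually.mono (residual_of_dense_open (s := {h | ∃ g : UnitaryV Q,
      (∀ j : Fin K, SupportedIn (Ici N) (g (basis Q j))) ∧
        ∀ i, ∀ j : Fin K, h i (g (basis Q j)) = g (c i j)}) ?_ fun h => ?_) fun h hh _ => hh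
    · have : {h : Fin m → UnitaryV Q | ∃ g : UnitaryV Q,
          (∀ j : Fin K, SupportedIn (Ici N) (g (basis Q j))) ∧
          ∀ i, ∀ j : Fin K, h i (g (basis Q j)) = g (c i j)} =
          ⋃ g : UnitaryV Q, ⋃ (_ : ∀ j : Fin K, SupportedIn (Ici N) (g (basis Q j))),
            ⋂ i, ⋂ j : Fin K, (fun h : Fin m → UnitaryV Q => h i) ⁻¹'
              {T | T (g (basis Q j)) = g (c i j)} := by
        ext h
        simp
      rw [this]
      exact isOpen_iUnion fun g => isOpen_iUnion fun _ => isOpen_iInter_of_finite fun i =>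
        isOpen_iInter_of_finite fun j => (isOpen_setOf_apply_eq _ _).preimage (by fun_prop)
    · refine mem_closure_iff_nhds.2 fun U hU => ?_
      obtain ⟨I, L, hI, hIL⟩ := exists_finite_of_mem_nhds_pi hU
      obtain ⟨K', hK'⟩ := exists_finite_support_pi hQ h (Set.finite_univ) L
      obtain ⟨M, hMK', hMN, hMK, hML⟩ : ∃ M, K' ≤ M ∧ N ≤ M ∧ K ≤ M ∧ L ≤ M :=
        ⟨K' + N + K + L, by omega, by omega, by omega, by omega⟩
      obtain ⟨u, hu⟩ := hK' M hMK'
      obtain ⟨σ, hσ⟩ := exists_perm_shift_initial hMK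
      have hσM : σ '' Iio K ⊆ Ici M := by
        rintro _ ⟨j, hj, rfl⟩
        exact hσ j hj
      have hmem : ∀ i, permHom Q σ * k i * (permHom Q σ)⁻¹ ∈ supportSubgroup Q (Ici M) := fun i =>
        supportSubgroup_mono hσM (permHom_conj_mem (hk i).1 σ)
      -- The copy of `k` is placed beyond `M`, where `u` acts trivially, so the prescribed columns
      -- below `L` are unchanged.
      refine ⟨fun i => u i * (permHom Q σ * k i * (permHom Q σ)⁻¹), hIL _ fun i _ j hj => ?_,
        permHom Q σ, fun j => ?_, fun i j => ?_⟩
      · rw [mul_apply, apply_eq_self_of_mem (hmem i) (disjoint_Iio_Ici M).symm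
          (.basis (mem_Iio.2 (hj.trans_le hML))), (hu i trivial).2 j hj]
      · rw [permHom_basis]
        exact .basis (hMN.trans (hσ j j.2))
      · have hb : SupportedIn (Ici M) (permHom Q σ (basis Q j)) := by
          rw [permHom_basis]
          exact .basis (hσ j j.2)
        have hb' := supportedIn_of_mem (hmem i) subset_rfl hb
        rw [mul_apply, apply_eq_self_of_mem (hu i trivial).1 (disjoint_Iio_Ici M) hb']
        simp only [mul_apply, inv_apply_self, (hk i).2 j]
  filter_upwards [h1, h2] with h hh1 hh2
  refine ⟨hh1, fun N K k hk => ?_⟩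
  obtain ⟨g, hg1, hg2⟩ := hh2 N K (fun i j => k i (basis Q j)) ⟨k, fun i => ⟨hk i, fun j => rfl⟩⟩
  exact ⟨g, fun j hj => hg1 ⟨j, hj⟩, fun i j hj => hg2 i ⟨j, hj⟩⟩

/-! ### Back-and-forth between generic tuples. -/

/-- One half of the back-and-forth between two generic tuples. -/
theorem IsGenericTuple.exists_inverse_extension (hQ : ∀ z ∈ Q, conj z ∈ Q) {m : ℕ}
    {h h' : Fin m → UnitaryV Q} (hh : IsGenericTuple h) (hh' : IsGenericTuple h') {g : UnitaryV Q}
    {K : ℕ} (hK : ∀ i, Preserves K (h i))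
    (hg : ∀ i, ∀ j < K, g (h i (basis Q j)) = h' i (g (basis Q j))) (N : ℕ) :
    ∃ (g' : UnitaryV Q) (K' : ℕ), N ≤ K' ∧ (∀ i, Preserves K' (h' i)) ∧
      (∀ j < K, SupportedIn (Iio K') (g (basis Q j))) ∧ (∀ j < K, g' (g (basis Q j)) = basis Q j) ∧
      ∀ i, ∀ j < K', g' (h' i (basis Q j)) = h i (g' (basis Q j)) := by
  obtain ⟨K₀, hK₀⟩ := exists_supportedIn_Iio_of_finite fun j : Fin K => g (basis Q j)
  obtain ⟨K', hK', hpres'⟩ := hh'.exists_preserves (max N K₀)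
  have hgK : ∀ j < K, SupportedIn (Iio K') (g (basis Q j)) := fun j hj =>
    hK₀ K' ((le_max_right _ _).trans hK') ⟨j, hj⟩
  -- The restriction of `h'` to the initial span of length `K'` becomes a tuple of finite support,
  -- so genericity of `h` provides a copy `ψ` of it orthogonal to the first `K` basis vectors.
  have hk : ∀ i, ∃ k ∈ supportSubgroup Q (Iio K'), ∀ j < K', k (basis Q j) = h' i (basis Q j) :=
    fun i => exists_map_eq_of_inner_eq hQ (fun j hj => .basis hj) (fun j hj => (hpres' i j hj).1)
      fun _ _ _ _ => by rw [inner_map_map]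
  choose k hkmem hk using hk
  obtain ⟨ψ, hψ, hψk⟩ := hh.exists_copy K K' k hkmem
  have hψsupp : ∀ x, SupportedIn (Iio K') x → SupportedIn (Ici K) (ψ x) := fun x hx =>
    supportedIn_of_basis hψ hx
  have hψeq : ∀ i x, SupportedIn (Iio K') x → h i (ψ x) = ψ (h' i x) := fun i x hx =>
    apply_eq_of_supportedIn (S := h i * ψ) (T := ψ * h' i)
      (fun j hj => by rw [mul_apply, mul_apply, hψk i j hj, hk i j hj]) hx
  -- On the image under `g` of the initial span of length `K`, `θ` is `g⁻¹`; on its orthogonal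
  -- complement within the span of length `K'` it is `ψ`. The two ranges are orthogonal, so `θ` is
  -- isometric there.
  obtain ⟨θ, hθ⟩ : ∃ θ : ratSpan Q → ratSpan Q, ∀ x, θ x =
    truncate K (g⁻¹ x) + ψ (x - g (truncate K (g⁻¹ x))) := ⟨_, fun _ => rfl⟩
  have hsub : ∀ x, SupportedIn (Iio K') x →
      SupportedIn (Iio K') (x - g (truncate K (g⁻¹ x))) := fun x hx =>
    hx.sub (supportedIn_of_basis hgK (supportedIn_truncate K _))
  have hinner : ∀ x y, SupportedIn (Iio K') x → SupportedIn (Iio K') y →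
      ⟪(θ x : EllTwo), (θ y : EllTwo)⟫ = ⟪(x : EllTwo), (y : EllTwo)⟫ := by
    intro x y hx hy
    have hxg : ∀ x, x - g (truncate K (g⁻¹ x)) = g (g⁻¹ x - truncate K (g⁻¹ x)) := fun x => by
      rw [map_sub, apply_inv_self]
    have c1 := (supportedIn_truncate K (g⁻¹ x)).inner_eq_zero (disjoint_Iio_Ici K)
      (hψsupp _ (hsub y hy))
    have c2 := (hψsupp _ (hsub x hx)).inner_eq_zero (disjoint_Iio_Ici K).symm
      (supportedIn_truncate K (g⁻¹ y))
    rw [hθ, hθ, Submodule.coe_add, Submodule.coe_add, inner_add_left, inner_add_right,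
      inner_add_right, c1, c2, inner_map_map, hxg, hxg, inner_map_map, add_zero, zero_add,
      inner_truncate_add, inner_map_map]
  obtain ⟨g', -, hg'⟩ := exists_map_eq_of_inner_eq hQ (A := univ) (n := K')
    (x := fun j => basis Q j) (y := fun j => θ (basis Q j))
    (fun _ _ j hj => (hj trivial).elim) (fun _ _ j hj => (hj trivial).elim)
    fun i hi j hj => (hinner _ _ (.basis hi) (.basis hj)).symm
  have hg'θ : ∀ x, SupportedIn (Iio K') x → g' x = θ x := by
    intro x hx
    obtain ⟨s, c, hs, rfl⟩ := hx.eq_sum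
    rw [map_sum, Finset.sum_congr rfl fun i hi => by rw [map_smul, hg' i (hs i hi), hθ], hθ]
    simp only [map_sum, map_smul, map_sub, smul_add, smul_sub, Finset.sum_add_distrib,
      Finset.sum_sub_distrib]
  refine ⟨g', K', (le_max_left _ _).trans hK', hpres', hgK, fun j hj => ?_, fun i j hj => ?_⟩
  · rw [hg'θ _ (hgK j hj), hθ, inv_apply_self, truncate_eq_self (.basis hj), sub_self, map_zero,
      add_zero]
  -- The conjugate of `h'` by `g` agrees with `h` on the span of length `K`, hence preserves it and
  -- commutes with `truncate K`. So both summands of `θ` intertwine `h'` with `h`.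
  · have hf : ∀ x, SupportedIn (Iio K) x → (g⁻¹ * h' i * g) x = h i x := fun x hx =>
      apply_eq_of_supportedIn (fun j hj => by
        rw [mul_apply, mul_apply, ← hg i j hj, inv_apply_self]) hx
    have hpres : Preserves K (g⁻¹ * h' i * g) := fun j hj =>
      ⟨by rw [hf _ (.basis hj)]; exact (hK i j hj).1, by
        have hinv : (g⁻¹ * h' i * g)⁻¹ (basis Q j) = (h i)⁻¹ (basis Q j) :=
          inv_apply_eq_iff.2 (by rw [hf _ (hK i j hj).2, apply_inv_self])
        rw [hinv]
        exact (hK i j hj).2⟩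
    have hb : SupportedIn (Iio K') (basis Q j) := .basis hj
    have htr : truncate K (g⁻¹ (h' i (basis Q j))) = h i (truncate K (g⁻¹ (basis Q j))) := by
      rw [← hf _ (supportedIn_truncate K _), ← hpres.truncate_apply]
      simp
    have hgtr : g (h i (truncate K (g⁻¹ (basis Q j)))) =
        h' i (g (truncate K (g⁻¹ (basis Q j)))) := by
      rw [← hf _ (supportedIn_truncate K _)]
      simp
    rw [hg'θ _ (hpres' i j hj).1, hg'θ _ hb, hθ, hθ, htr, hgtr, map_add, hψeq i _ (hsub _ hb),
      map_sub (h' i)]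

/-- A full step of the back-and-forth between two generic tuples. -/
theorem IsGenericTuple.exists_extension (hQ : ∀ z ∈ Q, conj z ∈ Q) {m : ℕ}
    {h h' : Fin m → UnitaryV Q} (hh : IsGenericTuple h) (hh' : IsGenericTuple h') {g : UnitaryV Q}
    {K : ℕ} (hK : ∀ i, Preserves K (h i))
    (hg : ∀ i, ∀ j < K, g (h i (basis Q j)) = h' i (g (basis Q j))) (N : ℕ) :
    ∃ (g' : UnitaryV Q) (K' : ℕ), (∀ i, Preserves K' (h i)) ∧
      (∀ i, ∀ j < K', g' (h i (basis Q j)) = h' i (g' (basis Q j))) ∧ N ≤ K' ∧ K ≤ K' ∧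
      (∀ j < K, g' (basis Q j) = g (basis Q j)) ∧
      ∀ j < N, SupportedIn (Iio K') (g'⁻¹ (basis Q j)) := by
  -- Two half steps with exchanged roles: `g₁` extends the inverse of the partial map `g`, and `g₂`
  -- the inverse of the partial map `g₁`, so `g₂` extends `g` and has the first `N` basis vectors in
  -- its range.
  obtain ⟨g₁, K₁, hN₁, hp₁, hs₁, hg₁, he₁⟩ := hh.exists_inverse_extension hQ hh' hK hg N
  obtain ⟨g₂, K₂, hN₂, hp₂, hs₂, hg₂, he₂⟩ :=
    hh'.exists_inverse_extension hQ hh hp₁ he₁ (max N K)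
  refine ⟨g₂, K₂, hp₂, he₂, (le_max_left _ _).trans hN₂, (le_max_right _ _).trans hN₂,
    fun j hj => ?_, fun j hj => ?_⟩
  · have := apply_eq_of_supportedIn (S := g₂ * g₁) (T := 1) (fun i hi => hg₂ i hi) (hs₁ j hj)
    rwa [mul_apply, hg₁ j hj, one_apply] at this
  · rw [inv_apply_eq_iff.2 (hg₂ j (hj.trans_le hN₁)).symm]
    exact hs₂ j (hj.trans_le hN₁)

/-- A sequence of isometries that stabilizes on the basis together with the sequence of inverses
has a limit. -/
theorem exists_limit {g : ℕ → UnitaryV Q} {x y : ℕ → ratSpan Q}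
    (hx : ∀ j, ∀ᶠ n in atTop, g n (basis Q j) = x j)
    (hy : ∀ j, ∀ᶠ n in atTop, (g n)⁻¹ (basis Q j) = y j) :
    ∃ T : UnitaryV Q, ∀ j, T (basis Q j) = x j := by
  have hortho : ∀ (g : ℕ → UnitaryV Q) (x : ℕ → ratSpan Q),
      (∀ j, ∀ᶠ n in atTop, g n (basis Q j) = x j) → Orthonormal ℂ fun j => (x j : EllTwo) := by
    refine fun g x hx => orthonormal_iff_ite.2 fun i j => ?_
    obtain ⟨n, hi, hj⟩ := ((hx i).and (hx j)).exists
    rw [← hi, ← hj]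
    exact orthonormal_iff_ite.1 (g n).orthonormal_map_basis i j
  obtain ⟨T, hT, -⟩ := exists_of_adjoint (hortho g x hx) (hortho (fun n => (g n)⁻¹) y hy)
    fun i j => by
      obtain ⟨n, hi, hj⟩ := ((hx i).and (hy j)).exists
      rw [← hi, ← hj, ← coe_basis (Q := Q), ← coe_basis (Q := Q), inner_map_left]
  exact ⟨T, hT⟩

theorem IsGenericTuple.mem_diagonalConjClass (hQ : ∀ z ∈ Q, conj z ∈ Q) {m : ℕ}
    {h h' : Fin m → UnitaryV Q} (hh : IsGenericTuple h) (hh' : IsGenericTuple h') :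
    h' ∈ diagonalConjClass h := by
  let State := {p : UnitaryV Q × ℕ // (∀ i, Preserves p.2 (h i)) ∧
    ∀ i, ∀ j < p.2, p.1 (h i (basis Q j)) = h' i (p.1 (basis Q j))}
  have hstep : ∀ (N : ℕ) (p : State), ∃ p' : State, N ≤ p'.1.2 ∧ p.1.2 ≤ p'.1.2 ∧
      (∀ j < p.1.2, p'.1.1 (basis Q j) = p.1.1 (basis Q j)) ∧
      ∀ j < N, SupportedIn (Iio p'.1.2) (p'.1.1⁻¹ (basis Q j)) := fun N p => by
    obtain ⟨g', K', h1, h2, h3⟩ := hh.exists_extension hQ hh' p.2.1 p.2.2 N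
    exact ⟨⟨(g', K'), h1, h2⟩, h3⟩
  choose F hF using hstep
  obtain ⟨s, hs⟩ : ∃ s : ℕ → State, ∀ n, s (n + 1) = F n (s n) :=
    ⟨fun n => Nat.rec ⟨(1, 0), fun _ _ hj => absurd hj (Nat.not_lt_zero _),
      fun _ _ hj => absurd hj (Nat.not_lt_zero _)⟩ (fun n p => F n p) n, fun _ => rfl⟩
  have hmono : Monotone fun n => (s n).1.2 := monotone_nat_of_le_succ fun n => by
    rw [hs]
    exact (hF n (s n)).2.1
  have hagree : ∀ n k, n ≤ k → ∀ j < (s n).1.2,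
      (s k).1.1 (basis Q j) = (s n).1.1 (basis Q j) := by
    intro n k hnk
    induction k, hnk using Nat.le_induction with
    | base => exact fun _ _ => rfl
    | succ k hnk ih =>
      intro j hj
      rw [hs, (hF k (s k)).2.2.1 j (hj.trans_le (hmono hnk)), ih j hj]
  -- Stage `j + 2` is built with bound `N = j + 1`, which exceeds `j`; from then on both the image
  -- and the preimage of the `j`-th basis vector are settled.
  have hlt : ∀ j, j < (s (j + 2)).1.2 := fun j => by
    rw [hs]
    exact (hF (j + 1) _).1
  have hinv : ∀ j, SupportedIn (Iio (s (j + 2)).1.2) ((s (j + 2)).1.1⁻¹ (basis Q j)) := fun j => by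
    rw [hs]
    exact (hF (j + 1) _).2.2.2 j j.lt_succ_self
  obtain ⟨T, hT⟩ := exists_limit (g := fun n => (s n).1.1)
    (x := fun j => (s (j + 2)).1.1 (basis Q j)) (y := fun j => (s (j + 2)).1.1⁻¹ (basis Q j))
    (fun j => (eventually_ge_atTop (j + 2)).mono fun n hn => hagree _ _ hn j (hlt j))
    (fun j => (eventually_ge_atTop (j + 2)).mono fun n hn => inv_apply_eq_iff.2 (by
      rw [apply_eq_of_supportedIn (hagree _ _ hn) (hinv j), apply_inv_self]))
  have hTs : ∀ n, ∀ x, SupportedIn (Iio (s n).1.2) x → T x = (s n).1.1 x := fun n x hx =>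
    apply_eq_of_supportedIn (fun j hj => by
      rw [hT, ← hagree _ _ (le_max_left (j + 2) n) j (hlt j),
        hagree _ _ (le_max_right (j + 2) n) j hj]) hx
  refine ⟨T, funext fun i => ?_⟩
  rw [mul_inv_eq_iff_eq_mul]
  refine ext_basis fun j => ?_
  have hj : SupportedIn (Iio (s (j + 2)).1.2) (basis Q j) := .basis (hlt j)
  rw [mul_apply, mul_apply, hTs _ _ hj, hTs _ _ ((s (j + 2)).2.1 i j (hlt j)).1,
    (s (j + 2)).2.2 i j (hlt j)]

theorem hasAmpleGenerics [Countable Q] (hQ : ∀ z ∈ Q, conj z ∈ Q) :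
    HasAmpleGenerics (UnitaryV Q) := by
  refine ⟨isPolishGroup, fun m _ => ?_⟩
  have hres := eventually_residual_isGenericTuple hQ m
  obtain ⟨h, hh⟩ := (dense_of_mem_residual hres).nonempty
  exact ⟨h, mem_of_superset hres fun h' hh' => hh.mem_diagonalConjClass hQ hh'⟩

end UnitaryV

theorem mainTheorem7 (Q : Subfield ℂ) (hQcount : Countable Q) (hQclosed : IsAlgClosed Q)
    (hQconj : ∀ z ∈ Q, conj z ∈ Q) :
    HasAmpleGenerics (UnitaryV Q) ∧
    HasAmpleCyclicallyDenseConjClass (UnitaryV Q) ∧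
    HasBergmanProperty (UnitaryV Q) ∧
    (∀ T : UnitaryV Q, ∃! S : UnitaryEllTwo, Extends S T) ∧
    Dense {S : UnitaryEllTwo | ∃ T : UnitaryV Q, Extends S T} ∧
    HasPropertyOB.{0, v} UnitaryEllTwo ∧
    HasAmpleCyclicallyDenseConjClass UnitaryEllTwo :=
  have hd := UnitaryV.denseRange_extendHom hQconj
  ⟨UnitaryV.hasAmpleGenerics hQconj, UnitaryV.hasAmpleCyclicallyDenseConjClass hQconj,
    UnitaryV.hasBergmanProperty hQconj, UnitaryV.existsUnique_extends,
    UnitaryV.dense_setOf_extends hQconj, (UnitaryV.hasBergmanProperty hQconj).hasPropertyOB hd,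
    (UnitaryV.hasAmpleCyclicallyDenseConjClass hQconj).map UnitaryEllTwo.isPolishGroup
      UnitaryV.continuous_extendHom hd⟩
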